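/- Let $\Gamma$ be a finite group and $\Gamma'\subseteq\Gamma$ a subgroup. Let $e_{\Gamma/\Gamma'}$ be the central idempotent of $\mathbb{Q}[\Gamma]$ associated to the augmentation character $a_{\Gamma/\Gamma'}=\mathrm{Ind}_{\Gamma'}^{\Gamma}1-1$, i.e. the minimal central idempotent acting as the identity on a representation with character $a_{\Gamma/\Gamma'}$, and let $e_1'=\frac{1}{|\Gamma'|}\sum_{\tau\in\Gamma'}\tau$. Call a prime $p$ good for $e_{\Gamma/\Gamma'}$ if $e_{\Gamma/\Gamma'}\in\mathbb{Z}_{(p)}[\Gamma]$ and $e_{\Gamma/\Gamma'}\mathbb{Z}_{(p)}[\Gamma]$ is a maximal $\mathbb{Z}_{(p)}$-order in $e_{\Gamma/\Gamma'}\mathbb{Q}[\Gamma]$. Let $S$ be a finite set of primes that are good for $e_{\Gamma/\Gamma'}$, let $\mathbb{Z}_S\subseteq\mathbb{Q}$ be the localization of $\mathbb{Z}$ at the nonzero integers not divisible by any prime in $S$, and let $\mathfrak{O}\subseteq\mathbb{Q}[\Gamma]$ be a maximal $\mathbb{Z}_S$-order containing $\mathbb{Z}_S[\Gamma]$. Write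 ${}^{\Gamma'}M$ for the elements of $M$ fixed by $\Gamma'$ acting on the left, regard $e_{\Gamma/\Gamma'}\mathfrak{O}$ as a ring with identity $e_{\Gamma/\Gamma'}$, and let \[\mathfrak{o}={}^{\Gamma'}(e_{\Gamma/\Gamma'}\mathfrak{O}e_1'),\] a ring with identity $e_{\Gamma/\Gamma'}e_1'$ under the multiplication of $\mathbb{Q}[\Gamma]$. Then $e_{\Gamma/\Gamma'}\mathfrak{O}$ and $\mathfrak{o}$ are Morita equivalent (as $\mathbb{Z}_S$-algebras): the functors \[{}^{\Gamma'}(e_{\Gamma/\Gamma'}\mathfrak{O})\otimes_{e_{\Gamma/\Gamma'}\mathfrak{O}}-\;:\;e_{\Gamma/\Gamma'}\mathfrak{O}\text{-Mod}\to\mathfrak{o}\text{-Mod},\qquad e_{\Gamma/\Gamma'}\mathfrak{O}e_1'\otimes_{\mathfrak{o}}-\;:\;\mathfrak{o}\text{-Mod}\to e_{\Gamma/\Gamma'}\mathfrak{O}\text{-Mod}\] are mutually inverse equivalences of categories, the bimodule structures being given by multiplication in $\mathbb{Q}[\Gamma]$. Moreover, for every left $e_{\Gamma/\Gamma'}\mathfrak{O}$-module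 $G$ (on which $\gamma\in\Gamma$ acts through $e_{\Gamma/\Gamma'}\gamma$), the rule $(\sigma e_1')\cdot g=\sigma g$, for $\sigma\in e_{\Gamma/\Gamma'}\mathfrak{O}$ with $\sigma e_1'\in\mathfrak{o}$, makes ${}^{\Gamma'}G$ an $\mathfrak{o}$-module, and $x\otimes g\mapsto xg$ is an isomorphism of $\mathfrak{o}$-modules ${}^{\Gamma'}(e_{\Gamma/\Gamma'}\mathfrak{O})\otimes_{e_{\Gamma/\Gamma'}\mathfrak{O}}G\to{}^{\Gamma'}G$. -/

import Mathlib

open CategoryTheory TensorProduct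

universe u v

noncomputable section

namespace HeckeModel

/-! ### Rings and bimodules inside an ambient ring -/

section Ambient

/-- An `R`-submodule of `A`, closed under multiplication, which is a ring with identity `one'`;
the identity need not be the identity of `A`. -/
structure SubRingWithOne (R A : Type*) [CommRing R] [Ring A] [Algebra R A]
    extends Submodule R A where
  one' : A
  one_mem' : one' ∈ carrier
  mul_mem' : ∀ {x y : A}, x ∈ carrier → y ∈ carrier → x * y ∈ carrier
  one_mul' : ∀ {x : A}, x ∈ carrier → one' * x = x
  mul_one' : ∀ {x : A}, x ∈ carrier → x * one' = x

variable {R : Type*} {A : Type u} [CommRing R] [Ring A] [Algebra R A]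

/-- The underlying type of `B`. -/
def SubRingWithOne.Elt (B : SubRingWithOne R A) : Type u := B.toSubmodule

instance (B : SubRingWithOne R A) : AddCommGroup B.Elt :=
  inferInstanceAs (AddCommGroup B.toSubmodule)

instance (B : SubRingWithOne R A) : Module R B.Elt :=
  inferInstanceAs (Module R B.toSubmodule)

instance (B : SubRingWithOne R A) : Ring B.Elt where
  __ := (inferInstance : AddCommGroup B.Elt)
  mul x y := ⟨x.1 * y.1, B.mul_mem' x.2 y.2⟩
  one := ⟨B.one', B.one_mem'⟩
  mul_assoc x y z := Subtype.ext (mul_assoc x.1 y.1 z.1)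
  one_mul x := Subtype.ext (B.one_mul' x.2)
  mul_one x := Subtype.ext (B.mul_one' x.2)
  left_distrib x y z := Subtype.ext (mul_add x.1 y.1 z.1)
  right_distrib x y z := Subtype.ext (add_mul x.1 y.1 z.1)
  zero_mul x := Subtype.ext (zero_mul x.1)
  mul_zero x := Subtype.ext (mul_zero x.1)

instance (B : SubRingWithOne R A) : Algebra R B.Elt :=
  Algebra.ofModule (fun r x y => Subtype.ext (smul_mul_assoc r x.1 y.1))
    (fun r x y => Subtype.ext (mul_smul_comm r x.1 y.1))

/-- An `R`-submodule of `A` which is a `(B, C)`-bimodule under multiplication in `A`. -/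
structure SubBimodule (B C : SubRingWithOne R A) extends Submodule R A where
  left_mem' : ∀ {b x : A}, b ∈ B.carrier → x ∈ carrier → b * x ∈ carrier
  right_mem' : ∀ {x c : A}, x ∈ carrier → c ∈ C.carrier → x * c ∈ carrier
  one_left' : ∀ {x : A}, x ∈ carrier → B.one' * x = x
  one_right' : ∀ {x : A}, x ∈ carrier → x * C.one' = x

/-- The underlying type of `P`. -/
def SubBimodule.Elt {B C : SubRingWithOne R A} (P : SubBimodule B C) : Type u := P.toSubmodule

variable {B C : SubRingWithOne R A}

instance (P : SubBimodule B C) : AddCommGroup P.Elt :=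
  inferInstanceAs (AddCommGroup P.toSubmodule)

instance (P : SubBimodule B C) : Module B.Elt P.Elt where
  smul b x := ⟨b.1 * x.1, P.left_mem' b.2 x.2⟩
  one_smul x := Subtype.ext (P.one_left' x.2)
  mul_smul b c x := Subtype.ext (mul_assoc b.1 c.1 x.1)
  smul_zero b := Subtype.ext (mul_zero b.1)
  smul_add b x y := Subtype.ext (mul_add b.1 x.1 y.1)
  add_smul b c x := Subtype.ext (add_mul b.1 c.1 x.1)
  zero_smul x := Subtype.ext (zero_mul x.1)

instance (P : SubBimodule B C) : Module C.Eltᵐᵒᵖ P.Elt where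
  smul c x := ⟨x.1 * c.unop.1, P.right_mem' x.2 c.unop.2⟩
  one_smul x := Subtype.ext (P.one_right' x.2)
  mul_smul c d x := Subtype.ext (mul_assoc x.1 d.unop.1 c.unop.1).symm
  smul_zero c := Subtype.ext (zero_mul c.unop.1)
  smul_add c x y := Subtype.ext (add_mul x.1 y.1 c.unop.1)
  add_smul c d x := Subtype.ext (mul_add x.1 c.unop.1 d.unop.1)
  zero_smul x := Subtype.ext (mul_zero x.1)

instance (P : SubBimodule B C) : SMulCommClass B.Elt C.Eltᵐᵒᵖ P.Elt where
  smul_comm b c x := Subtype.ext (mul_assoc b.1 x.1 c.unop.1).symm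

end Ambient

/-! ### Tensor product over a noncommutative ring -/

section Tensor

variable (T : Type*) (R : Type*) [Ring T] [Ring R]
variable (M : Type*) [AddCommGroup M] [Module T M] [Module Rᵐᵒᵖ M] [SMulCommClass T Rᵐᵒᵖ M]

/-- The relations `(m r) ⊗ n = m ⊗ (r n)`. As `M` is a `(T, R)`-bimodule, the set of these
relations is stable under `T`, so its `T`-span is the additive subgroup it generates. -/
def tensorRel (N : Type*) [AddCommGroup N] [Module R N] : Submodule T (M ⊗[ℤ] N) :=
  Submodule.span T {t | ∃ (m : M) (r : R) (n : N),
    t = (MulOpposite.op r • m) ⊗ₜ[ℤ] n - m ⊗ₜ[ℤ] (r • n)}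

/-- The tensor product `M ⊗_R N` of a `(T, R)`-bimodule `M` and a left `R`-module `N`,
as a left `T`-module. -/
abbrev BTensor (N : Type*) [AddCommGroup N] [Module R N] : Type _ :=
  (M ⊗[ℤ] N) ⧸ tensorRel T R M N

variable {N : Type*} [AddCommGroup N] [Module R N] {M} in
/-- The pure tensor `m ⊗ n` in `M ⊗_R N`. -/
def btmul (m : M) (n : N) : BTensor T R M N :=
  (tensorRel T R M N).mkQ (m ⊗ₜ[ℤ] n)

variable {N N' : Type*} [AddCommGroup N] [Module R N] [AddCommGroup N'] [Module R N'] in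
/-- The map `id ⊗ f : M ⊗_R N → M ⊗_R N'`. -/
def btensorMap (f : N →ₗ[R] N') : BTensor T R M N →ₗ[T] BTensor T R M N' :=
  Submodule.mapQ (tensorRel T R M N) (tensorRel T R M N')
    (TensorProduct.AlgebraTensorModule.lTensor T M (f.restrictScalars ℤ)) (by
      rw [tensorRel, Submodule.span_le]
      rintro _ ⟨m, r, n, rfl⟩
      refine Submodule.subset_span ⟨m, r, f n, ?_⟩
      simp)

/-- The functor `M ⊗_R - : R-Mod ⥤ T-Mod` for a `(T, R)`-bimodule `M`. -/
def tensorFunctor (T R M : Type u) [Ring T] [Ring R] [AddCommGroup M] [Module T M]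
    [Module Rᵐᵒᵖ M] [SMulCommClass T Rᵐᵒᵖ M] :
    ModuleCat.{max u v} R ⥤ ModuleCat.{max u v} T where
  obj N := ModuleCat.of T (BTensor T R M N)
  map f := ModuleCat.ofHom (btensorMap T R M f.hom)
  map_id N := ModuleCat.hom_ext (Submodule.linearMap_qext _ (by
    ext m n
    simp [btensorMap]))
  map_comp f g := ModuleCat.hom_ext (Submodule.linearMap_qext _ (by
    ext m n
    simp [btensorMap]))

end Tensor

/-! ### Orders and good primes -/

/-- `ℤ_S`, the localization of `ℤ` at the nonzero integers not divisible by any prime in `S`,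
as a subring of `ℚ`. -/
def zS (S : Set Nat.Primes) : Subring ℚ where
  carrier := {q | ∀ p ∈ S, ¬ ((p : ℕ) ∣ q.den)}
  zero_mem' p _ := by simpa using p.2.one_lt.ne'
  one_mem' p _ := by simpa using p.2.one_lt.ne'
  neg_mem' {q} hq p hp := by simpa using hq p hp
  add_mem' {a b} ha hb p hp h :=
    (p.2.dvd_mul.1 (h.trans (Rat.add_den_dvd a b))).elim (ha p hp) (hb p hp)
  mul_mem' {a b} ha hb p hp h :=
    (p.2.dvd_mul.1 (h.trans (Rat.mul_den_dvd a b))).elim (ha p hp) (hb p hp)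

/-- `L` is an `R`-order in the `ℚ`-algebra `u A u` (with identity `u`), for an idempotent `u` of the
`ℚ`-algebra `A` and a subring `R` of `ℚ`: a subring with identity `u`, finitely generated over
`R`, whose `ℚ`-span is `u A u`. -/
structure IsOrder (R : Subring ℚ) {A : Type*} [Ring A] [Algebra ℚ A] (u : A)
    (L : Submodule R A) : Prop where
  one_mem : u ∈ L
  mul_mem : ∀ x ∈ L, ∀ y ∈ L, x * y ∈ L
  one_mul : ∀ x ∈ L, u * x = x
  mul_one : ∀ x ∈ L, x * u = x
  fg : L.FG
  span : ∀ x : A, u * x * u ∈ Submodule.span ℚ (L : Set A)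

/-- `L` is a maximal `R`-order in `u A u`. -/
def IsMaximalOrder (R : Subring ℚ) {A : Type*} [Ring A] [Algebra ℚ A] (u : A)
    (L : Submodule R A) : Prop :=
  IsOrder R u L ∧ ∀ L' : Submodule R A, IsOrder R u L' → L ≤ L' → L' = L

variable {Γ : Type u} [Group Γ]

/-- The group ring `R[Γ]` as an `R`-submodule of `ℚ[Γ]`. -/
def groupRing (R : Subring ℚ) (Γ : Type u) [Group Γ] : Submodule R (MonoidAlgebra ℚ Γ) :=
  Submodule.span R (Set.range (MonoidAlgebra.of ℚ Γ))

/-- The prime `p` is good for `e`: `e ∈ ℤ_(p)[Γ]` and `e ℤ_(p)[Γ]` is a maximal `ℤ_(p)`-order in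
`e ℚ[Γ]` (used for central idempotents `e`). -/
def IsGoodPrime (p : Nat.Primes) (e : MonoidAlgebra ℚ Γ) : Prop :=
  e ∈ groupRing (zS {p}) Γ ∧
    IsMaximalOrder (zS {p}) e ((groupRing (zS {p}) Γ).map (LinearMap.mulLeft (zS {p}) e))

/-! ### The idempotents -/

/-- `x` acts as the identity on the augmentation representation, the subrepresentation of the
permutation representation `ℚ[Γ/Γ']` of the vectors with coordinate sum zero; its character is
`Ind_{Γ'}^Γ 1 - 1`. -/
def ActsAsOne (Γ' : Subgroup Γ) (x : MonoidAlgebra ℚ Γ) : Prop :=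
  ∀ w : MonoidAlgebra ℚ (Γ ⧸ Γ'), (w.coeff.sum fun _ c => c) = 0 →
    (Representation.ofMulAction ℚ Γ (Γ ⧸ Γ')).asAlgebraHom x w = w

/-- `e` is the minimal central idempotent of `ℚ[Γ]` acting as the identity on the augmentation
representation. -/
structure IsAugIdempotent (Γ' : Subgroup Γ) (e : MonoidAlgebra ℚ Γ) : Prop where
  idem : e * e = e
  central : ∀ x, e * x = x * e
  acts : ActsAsOne Γ' e
  minimal : ∀ f : MonoidAlgebra ℚ Γ, f * f = f → (∀ x, f * x = x * f) → ActsAsOne Γ' f →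
    e * f = e

theorem IsAugIdempotent.unique {Γ' : Subgroup Γ} {e f : MonoidAlgebra ℚ Γ}
    (he : IsAugIdempotent Γ' e) (hf : IsAugIdempotent Γ' f) : e = f := by
  rw [← he.minimal f hf.idem hf.central hf.acts, he.central f,
    hf.minimal e he.idem he.central he.acts]

theorem exists_augIdempotent [Finite Γ] (Γ' : Subgroup Γ) :
    ∃ e : MonoidAlgebra ℚ Γ, IsAugIdempotent Γ' e := by
  classical
  have hfin : FiniteDimensional ℚ (MonoidAlgebra ℚ Γ) := inferInstance
  let d : MonoidAlgebra ℚ Γ → ℕ := fun e =>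
    Module.finrank ℚ (LinearMap.range (LinearMap.mulLeft ℚ e))
  let Q : MonoidAlgebra ℚ Γ → Prop := fun e =>
    e * e = e ∧ (∀ x, e * x = x * e) ∧ ActsAsOne Γ' e
  have h1 : Q 1 := ⟨one_mul 1, fun x => by simp, fun w _ => by simp⟩
  have hex : ∃ n, ∃ e, Q e ∧ d e = n := ⟨_, 1, h1, rfl⟩
  obtain ⟨e, he, hd⟩ := Nat.find_spec hex
  refine ⟨e, he.1, he.2.1, he.2.2, fun f hf hfc hfa => ?_⟩
  have hef : Q (e * f) := by
    refine ⟨?_, fun x => ?_, fun w hw => ?_⟩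
    · rw [mul_assoc, ← mul_assoc f e f, ← he.2.1 f, mul_assoc e f f, hf, ← mul_assoc, he.1]
    · rw [mul_assoc, hfc, ← mul_assoc, he.2.1, mul_assoc]
    · rw [map_mul, Module.End.mul_apply, hfa w hw, he.2.2 w hw]
  have hle : LinearMap.range (LinearMap.mulLeft ℚ (e * f)) ≤
      LinearMap.range (LinearMap.mulLeft ℚ e) := by
    rintro _ ⟨x, rfl⟩
    exact ⟨f * x, (mul_assoc _ _ _).symm⟩
  have hdim : d e ≤ d (e * f) := by
    rw [hd]
    exact Nat.find_min' hex ⟨_, hef, rfl⟩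
  have heq := Submodule.eq_of_le_of_finrank_le hle hdim
  have hmem : e ∈ LinearMap.range (LinearMap.mulLeft ℚ (e * f)) := by
    rw [heq]
    exact ⟨1, by simp⟩
  obtain ⟨x, hx⟩ := hmem
  have hx' : e * f * x = e := hx
  calc e * f = e * f * x * f := by rw [hx']
    _ = e * f * x := by
      rw [mul_assoc (e * f) x f, ← hfc x, ← mul_assoc, mul_assoc e f f, hf]
    _ = e := hx'

/-- The central idempotent `e_{Γ/Γ'}` associated to the augmentation character. -/
def augIdem [Finite Γ] (Γ' : Subgroup Γ) : MonoidAlgebra ℚ Γ :=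
  (exists_augIdempotent Γ').choose

theorem augIdem_spec [Finite Γ] (Γ' : Subgroup Γ) : IsAugIdempotent Γ' (augIdem Γ') :=
  (exists_augIdempotent Γ').choose_spec

/-- The idempotent `e₁' = |Γ'|⁻¹ ∑_{τ ∈ Γ'} τ`. -/
def trivIdem (Γ' : Subgroup Γ) : MonoidAlgebra ℚ Γ :=
  (Nat.card Γ' : ℚ)⁻¹ • ∑ᶠ τ : Γ', MonoidAlgebra.of ℚ Γ (τ : Γ)

section

variable [Finite Γ] (Γ' : Subgroup Γ)

theorem of_mul_trivIdem (τ : Γ') :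
    MonoidAlgebra.of ℚ Γ (τ : Γ) * trivIdem Γ' = trivIdem Γ' := by
  have := Fintype.ofFinite Γ'
  rw [trivIdem, finsum_eq_sum_of_fintype, mul_smul_comm, Finset.mul_sum]
  congr 1
  refine Fintype.sum_equiv (Equiv.mulLeft τ) _ _ fun σ => ?_
  simp [MonoidAlgebra.single_mul_single]

theorem trivIdem_mul {x : MonoidAlgebra ℚ Γ}
    (hx : ∀ τ ∈ Γ', MonoidAlgebra.of ℚ Γ τ * x = x) : trivIdem Γ' * x = x := by
  have := Fintype.ofFinite Γ'
  rw [trivIdem, finsum_eq_sum_of_fintype, smul_mul_assoc, Finset.sum_mul,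
    Finset.sum_congr rfl (fun (τ : Γ') _ => hx (τ : Γ) τ.2), Finset.sum_const, Finset.card_univ,
    ← Nat.card_eq_fintype_card, ← Nat.cast_smul_eq_nsmul ℚ, smul_smul, inv_mul_cancel₀, one_smul]
  exact_mod_cast Nat.card_pos.ne'

theorem trivIdem_idem : trivIdem Γ' * trivIdem Γ' = trivIdem Γ' :=
  trivIdem_mul Γ' fun τ hτ => of_mul_trivIdem Γ' ⟨τ, hτ⟩

end

/-! ### The rings `e_{Γ/Γ'} O` and `o`, and the bimodules -/

section Rings

variable [Finite Γ] {R : Subring ℚ} (Γ' : Subgroup Γ) (O : Subalgebra R (MonoidAlgebra ℚ Γ))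

/-- The ring `e_{Γ/Γ'} O`, with identity `e_{Γ/Γ'}`. -/
def eO : SubRingWithOne R (MonoidAlgebra ℚ Γ) where
  carrier := {a | ∃ x ∈ O, a = augIdem Γ' * x}
  zero_mem' := ⟨0, O.zero_mem, by simp⟩
  add_mem' := by
    rintro _ _ ⟨x, hx, rfl⟩ ⟨y, hy, rfl⟩
    exact ⟨x + y, O.add_mem hx hy, (mul_add _ _ _).symm⟩
  smul_mem' := by
    rintro r _ ⟨x, hx, rfl⟩
    exact ⟨r • x, O.smul_mem hx r, (mul_smul_comm _ _ _).symm⟩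
  one' := augIdem Γ'
  one_mem' := ⟨1, O.one_mem, by simp⟩
  mul_mem' := by
    rintro _ _ ⟨x, hx, rfl⟩ ⟨y, hy, rfl⟩
    refine ⟨x * y, O.mul_mem hx hy, ?_⟩
    have h := augIdem_spec Γ'
    rw [mul_assoc, ← mul_assoc x, ← h.central x, mul_assoc, ← mul_assoc, h.idem]
  one_mul' := by
    rintro _ ⟨x, hx, rfl⟩
    rw [← mul_assoc, (augIdem_spec Γ').idem]
  mul_one' := by
    rintro _ ⟨x, hx, rfl⟩
    rw [← (augIdem_spec Γ').central, ← mul_assoc, (augIdem_spec Γ').idem]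

/-- The integral model `o = ^{Γ'}(e_{Γ/Γ'} O e₁')` of the Hecke algebra, with identity
`e_{Γ/Γ'} e₁'`. -/
def heckeOrder : SubRingWithOne R (MonoidAlgebra ℚ Γ) where
  carrier := {a | (∃ x ∈ eO Γ' O |>.carrier, a = x * trivIdem Γ') ∧
    ∀ τ ∈ Γ', MonoidAlgebra.of ℚ Γ τ * a = a}
  zero_mem' := ⟨⟨0, (eO Γ' O).zero_mem', by simp⟩, by simp⟩
  add_mem' := by
    rintro _ _ ⟨⟨x, hx, rfl⟩, hx'⟩ ⟨⟨y, hy, rfl⟩, hy'⟩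
    refine ⟨⟨x + y, (eO Γ' O).add_mem' hx hy, (add_mul _ _ _).symm⟩, fun τ hτ => ?_⟩
    rw [mul_add, hx' τ hτ, hy' τ hτ]
  smul_mem' := by
    rintro r _ ⟨⟨x, hx, rfl⟩, hx'⟩
    refine ⟨⟨r • x, (eO Γ' O).smul_mem' r hx, (smul_mul_assoc _ _ _).symm⟩, fun τ hτ => ?_⟩
    rw [mul_smul_comm, hx' τ hτ]
  one' := augIdem Γ' * trivIdem Γ'
  one_mem' := by
    refine ⟨⟨_, (eO Γ' O).one_mem', rfl⟩, fun τ hτ => ?_⟩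
    rw [← mul_assoc, ← (augIdem_spec Γ').central, mul_assoc, of_mul_trivIdem Γ' ⟨τ, hτ⟩]
  mul_mem' := by
    rintro _ b ⟨⟨x, hx, rfl⟩, hx'⟩ ⟨⟨y, hy, rfl⟩, hy'⟩
    refine ⟨⟨x * y, (eO Γ' O).mul_mem' hx hy, ?_⟩, fun τ hτ => ?_⟩
    · rw [mul_assoc, trivIdem_mul Γ' hy', mul_assoc]
    · rw [← mul_assoc, hx' τ hτ]
  one_mul' := by
    rintro _ ⟨⟨x, hx, rfl⟩, hx'⟩
    rw [mul_assoc, trivIdem_mul Γ' hx', ← mul_assoc]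
    congr 1
    exact (eO Γ' O).one_mul' hx
  mul_one' := by
    rintro _ ⟨⟨x, hx, rfl⟩, hx'⟩
    rw [← mul_assoc, ← (augIdem_spec Γ').central, ← mul_assoc, mul_assoc, trivIdem_idem]
    congr 1
    exact (eO Γ' O).one_mul' hx

/-- The `(o, e_{Γ/Γ'} O)`-bimodule `^{Γ'}(e_{Γ/Γ'} O)`. -/
def leftInv : SubBimodule (heckeOrder Γ' O) (eO Γ' O) where
  carrier := {a | a ∈ (eO Γ' O).carrier ∧ ∀ τ ∈ Γ', MonoidAlgebra.of ℚ Γ τ * a = a}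
  zero_mem' := ⟨(eO Γ' O).zero_mem', by simp⟩
  add_mem' := by
    rintro x y ⟨hx, hx'⟩ ⟨hy, hy'⟩
    exact ⟨(eO Γ' O).add_mem' hx hy, fun τ hτ => by rw [mul_add, hx' τ hτ, hy' τ hτ]⟩
  smul_mem' := by
    rintro r x ⟨hx, hx'⟩
    exact ⟨(eO Γ' O).smul_mem' r hx, fun τ hτ => by rw [mul_smul_comm, hx' τ hτ]⟩
  left_mem' := by
    rintro _ x ⟨⟨y, hy, rfl⟩, hy'⟩ ⟨hx, hx'⟩
    refine ⟨?_, fun τ hτ => by rw [← mul_assoc, hy' τ hτ]⟩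
    rw [mul_assoc, trivIdem_mul Γ' hx']
    exact (eO Γ' O).mul_mem' hy hx
  right_mem' := by
    rintro x c ⟨hx, hx'⟩ hc
    exact ⟨(eO Γ' O).mul_mem' hx hc, fun τ hτ => by rw [← mul_assoc, hx' τ hτ]⟩
  one_left' := by
    rintro x ⟨hx, hx'⟩
    change augIdem Γ' * trivIdem Γ' * x = x
    rw [mul_assoc, trivIdem_mul Γ' hx']
    exact (eO Γ' O).one_mul' hx
  one_right' hx := (eO Γ' O).mul_one' hx.1

/-- The inclusion of `^{Γ'}(e_{Γ/Γ'} O)` in `e_{Γ/Γ'} O`. -/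
def leftInv.incl (x : (leftInv Γ' O).Elt) : (eO Γ' O).Elt := ⟨x.1, x.2.1⟩

/-- The `(e_{Γ/Γ'} O, o)`-bimodule `e_{Γ/Γ'} O e₁'`. -/
def rightProj : SubBimodule (eO Γ' O) (heckeOrder Γ' O) where
  carrier := {a | ∃ x ∈ (eO Γ' O).carrier, a = x * trivIdem Γ'}
  zero_mem' := ⟨0, (eO Γ' O).zero_mem', by simp⟩
  add_mem' := by
    rintro _ _ ⟨x, hx, rfl⟩ ⟨y, hy, rfl⟩
    exact ⟨x + y, (eO Γ' O).add_mem' hx hy, (add_mul _ _ _).symm⟩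
  smul_mem' := by
    rintro r _ ⟨x, hx, rfl⟩
    exact ⟨r • x, (eO Γ' O).smul_mem' r hx, (smul_mul_assoc _ _ _).symm⟩
  left_mem' := by
    rintro b _ hb ⟨x, hx, rfl⟩
    exact ⟨b * x, (eO Γ' O).mul_mem' hb hx, (mul_assoc _ _ _).symm⟩
  right_mem' := by
    rintro _ _ ⟨x, hx, rfl⟩ ⟨⟨y, hy, rfl⟩, hy'⟩
    exact ⟨x * y, (eO Γ' O).mul_mem' hx hy, by
      rw [mul_assoc, trivIdem_mul Γ' hy', mul_assoc]⟩
  one_left' := by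
    rintro _ ⟨x, hx, rfl⟩
    rw [← mul_assoc]
    congr 1
    exact (eO Γ' O).one_mul' hx
  one_right' := by
    rintro _ ⟨x, hx, rfl⟩
    change x * trivIdem Γ' * (augIdem Γ' * trivIdem Γ') = _
    rw [← mul_assoc, ← (augIdem_spec Γ').central, ← mul_assoc, mul_assoc, trivIdem_idem]
    congr 1
    exact (eO Γ' O).one_mul' hx

variable {O}

/-- The image `e_{Γ/Γ'} γ` of `γ ∈ Γ` in `e_{Γ/Γ'} O`, through which `Γ` acts on
`e_{Γ/Γ'} O`-modules. -/
def groupElt (hO : groupRing R Γ ≤ Subalgebra.toSubmodule O) (γ : Γ) : (eO Γ' O).Elt :=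
  ⟨augIdem Γ' * MonoidAlgebra.of ℚ Γ γ, _, hO (Submodule.subset_span ⟨γ, rfl⟩), rfl⟩

/-- The subgroup `^{Γ'}G` of `Γ'`-invariants of an `e_{Γ/Γ'} O`-module `G`. -/
def invariants (hO : groupRing R Γ ≤ Subalgebra.toSubmodule O) (G : Type*) [AddCommGroup G]
    [Module (eO Γ' O).Elt G] : AddSubgroup G where
  carrier := {g | ∀ τ ∈ Γ', groupElt Γ' hO τ • g = g}
  zero_mem' τ _ := smul_zero _
  add_mem' {x y} hx hy τ hτ := by rw [smul_add, hx τ hτ, hy τ hτ]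
  neg_mem' {x} hx τ hτ := by rw [smul_neg, hx τ hτ]

end Rings

end HeckeModel

end

/-!
Put `B = e_{Γ/Γ'} O`, `P = B e₁'` and `Q = ^{Γ'}B`. By the usual Morita argument everything follows
from `P Q = B` and `Q P = o`.

Good primes make `B` the order `e_{Γ/Γ'} ℤ_S[Γ]`, maximal because this can be tested one prime at a
time, so a two-sided ideal of `B` containing a nonzero integer `n` has right order `B`. If such an
ideal `I` is also reflexive, then `I = B`: since `B/n` is Artinian there is an ideal `K ∋ n` with
`I + K = B` and `(I K)^m ⊆ n B`; triviality of the multipliers of `I` and `K` lets one cancel the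
factors `I` one after the other, until some power of `K` lies in `n B ⊆ I`, which forces `I = B`.
The ideal `I = P Q` is reflexive, and it contains a nonzero integer because `e_{Γ/Γ'}` lies in the
two-sided ideal of `ℚ[Γ]` generated by `e_{Γ/Γ'} e₁'`. The multiplier property of `B` then passes
to `o`, where `Q P` is an idempotent ideal containing `|Γ'|`, so `Q P = o` for the same reason.

The action `(σ e₁') g = σ g` on `^{Γ'}G` does not depend on `σ` because `B ⊆ ℤ_S[Γ]`: if
`σ e₁' = 0`, then the coefficients of `σ` sum to zero over each coset `γ Γ'`.
-/

noncomputable section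

namespace HeckeModel

section Ideals

theorem exists_central_one_of_isTwoSided {Λ : Type*} [Ring Λ] [IsSemisimpleRing Λ]
    (I : Ideal Λ) [I.IsTwoSided] : ∃ e ∈ I, (∀ x, Commute e x) ∧ ∀ x ∈ I, e * x = x := by
  obtain ⟨e, he, rfl⟩ := IsSemisimpleRing.ideal_eq_span_idempotent I
  set I := Ideal.span {e}
  have heI : e ∈ I := Ideal.mem_span_singleton_self e
  have hright : ∀ x ∈ I, x * e = x := by
    intro x hx
    obtain ⟨c, rfl⟩ := Ideal.mem_span_singleton'.1 hx
    rw [mul_assoc, he]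
  have hzero : ∀ y ∈ I, e * y = 0 → y = 0 := by
    intro y hy hey
    obtain ⟨f, hf, hspan⟩ := IsSemisimpleRing.ideal_eq_span_idempotent (Ideal.span {y})
    obtain ⟨c, hc⟩ := Ideal.mem_span_singleton'.1 (hspan ▸ Ideal.mem_span_singleton_self f)
    have hfI : f ∈ I := hc ▸ I.mul_mem_left c hy
    have hf0 : f = 0 := by
      rw [← hf.eq, ← hc, ← mul_assoc, hc, ← hright _ (I.mul_mem_right c hfI), mul_assoc, hey,
        mul_zero]
    rw [hf0, Ideal.span_singleton_eq_bot.2 rfl, Ideal.span_singleton_eq_bot] at hspan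
    exact hspan
  have hleft : ∀ x ∈ I, e * x = x := fun x hx => by
    refine (sub_eq_zero.1 (hzero _ (I.sub_mem hx (I.mul_mem_left e hx)) ?_)).symm
    rw [mul_sub, ← mul_assoc, he, sub_self]
  refine ⟨e, heI, fun x => ?_, hleft⟩
  calc e * x = e * x * e := (hright _ (I.mul_mem_right x heI)).symm
    _ = x * e := by rw [mul_assoc, hleft _ (I.mul_mem_left x heI)]

theorem exists_isTwoSided_sup_eq_top_mul_eq_bot {Λ : Type*} [Ring Λ] [IsSemisimpleRing Λ]
    (I : Ideal Λ) [I.IsTwoSided] : ∃ K : Ideal Λ, K.IsTwoSided ∧ I ⊔ K = ⊤ ∧ I * K = ⊥ := by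
  obtain ⟨e, heI, hcomm, hone⟩ := exists_central_one_of_isTwoSided I
  let K : Ideal Λ := LinearMap.ker (LinearMap.toSpanSingleton Λ Λ e)
  have mem_K : ∀ y, y ∈ K ↔ y * e = 0 := fun _ => Iff.rfl
  refine ⟨K, ⟨fun {y} z hy => ?_⟩, ?_, ?_⟩
  · rw [mem_K] at hy ⊢
    rw [mul_assoc, ← (hcomm z).eq, ← mul_assoc, hy, zero_mul]
  · refine (Ideal.eq_top_iff_one _).2 (Submodule.mem_sup.2 ⟨e, heI, 1 - e, ?_, by abel⟩)
    rw [mem_K, sub_mul, one_mul, hone e heI, sub_self]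
  · refine eq_bot_iff.2 (Ideal.mul_le.2 fun x hx y hy => ?_)
    rw [Ideal.mem_bot, ← hone x hx, (hcomm x).eq, mul_assoc, (hcomm y).eq, (mem_K y).1 hy,
      mul_zero]

theorem sup_comap_eq_top {Λ B : Type*} [Ring Λ] [Ring B] {f : Λ →+* B}
    (hf : Function.Surjective f) {I : Ideal Λ} {K : Ideal B} (h : I.map f ⊔ K = ⊤) :
    I ⊔ K.comap f = ⊤ := by
  have hker : (⊥ : Ideal B).comap f ≤ K.comap f := Ideal.comap_mono bot_le
  rw [← sup_eq_left.2 (hker.trans le_sup_right), ← Ideal.comap_map_of_surjective f hf,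
    Ideal.map_sup, Ideal.map_comap_of_surjective f hf, h, Ideal.comap_top]

theorem mul_comap_le_comap {Λ B : Type*} [Ring Λ] [Ring B] (f : Λ →+* B) (I : Ideal Λ)
    (K : Ideal B) : I * K.comap f ≤ (I.map f * K).comap f :=
  Ideal.mul_le.2 fun x hx y hy => by
    rw [Ideal.mem_comap, map_mul]
    exact Ideal.mul_mem_mul (Ideal.mem_map_of_mem f hx) hy

theorem comap_pow_le_comap_pow {Λ B : Type*} [Ring Λ] [Ring B] (f : Λ →+* B)
    (K : Ideal B) [K.IsTwoSided] (m : ℕ) : K.comap f ^ m ≤ (K ^ m).comap f := by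
  induction m with
  | zero => rw [Submodule.pow_zero, Submodule.pow_zero, Ideal.one_eq_top, Ideal.one_eq_top,
      Ideal.comap_top]
  | succ m ih =>
    rw [Ideal.IsTwoSided.pow_succ, Ideal.IsTwoSided.pow_succ]
    refine Ideal.mul_le.2 fun x hx y hy => ?_
    rw [Ideal.mem_comap, map_mul]
    exact Ideal.mul_mem_mul hx (ih hy)

theorem exists_isTwoSided_sup_eq_top_mul_pow_eq_bot {Λ : Type*} [Ring Λ] [IsSemiprimaryRing Λ]
    (I : Ideal Λ) [I.IsTwoSided] :
    ∃ K : Ideal Λ, K.IsTwoSided ∧ I ⊔ K = ⊤ ∧ ∃ m, (I * K) ^ m = ⊥ := by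
  let π := Ideal.Quotient.mk (Ring.jacobson Λ)
  have hπ : Function.Surjective π := Ideal.Quotient.mk_surjective
  have : (I.map π).IsTwoSided := inferInstance
  obtain ⟨K, hK, hsup, hmul⟩ := exists_isTwoSided_sup_eq_top_mul_eq_bot (I.map π)
  obtain ⟨m, hm⟩ := IsSemiprimaryRing.isNilpotent (R := Λ)
  refine ⟨K.comap π, inferInstance, sup_comap_eq_top hπ hsup, m, eq_bot_iff.2 ?_⟩
  have hle : I * K.comap π ≤ Ring.jacobson Λ := by
    refine (mul_comap_le_comap π I K).trans ?_
    rw [hmul]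
    exact (Ideal.mk_ker).le
  exact (Ideal.pow_right_mono hle m).trans hm.le

theorem exists_isTwoSided_sup_eq_top_mul_pow_le {Λ : Type*} [Ring Λ] (I N : Ideal Λ)
    [I.IsTwoSided] [N.IsTwoSided] [IsSemiprimaryRing (Λ ⧸ N)] :
    ∃ K : Ideal Λ, K.IsTwoSided ∧ N ≤ K ∧ I ⊔ K = ⊤ ∧ ∃ m, (I * K) ^ m ≤ N := by
  let π := Ideal.Quotient.mk N
  have hπ : Function.Surjective π := Ideal.Quotient.mk_surjective
  have hker : (⊥ : Ideal (Λ ⧸ N)).comap π = N := Ideal.mk_ker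
  have : (I.map π).IsTwoSided := inferInstance
  obtain ⟨K, hK, hsup, m, hm⟩ := exists_isTwoSided_sup_eq_top_mul_pow_eq_bot (I.map π)
  refine ⟨K.comap π, inferInstance, ?_, sup_comap_eq_top hπ hsup, m, ?_⟩
  · exact hker.ge.trans (Ideal.comap_mono bot_le)
  · calc (I * K.comap π) ^ m ≤ ((I.map π * K).comap π) ^ m :=
        Ideal.pow_right_mono (mul_comap_le_comap π I K) m
      _ ≤ ((I.map π * K) ^ m).comap π := comap_pow_le_comap_pow π _ m
      _ = N := by rw [hm, hker]

section Multipliers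

variable {Λ : Type*} [Ring Λ] {n : Λ} {I K : Ideal Λ}

theorem isTwoSided_span_singleton (hn : ∀ x, Commute n x) : (Ideal.span {n}).IsTwoSided :=
  ⟨fun {x} y hx => by
    obtain ⟨c, rfl⟩ := Ideal.mem_span_singleton'.1 hx
    rw [mul_assoc, (hn y).eq, ← mul_assoc]
    exact Ideal.mul_mem_left _ _ (Ideal.mem_span_singleton_self n)⟩

/-- If `n` is a nonzerodivisor, this says that the fractions `n⁻¹ b`, `b ∈ Λ`, which multiply the
left ideal `K` into itself from the right all lie in `Λ`. Dividing by `n` is avoided, so that no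
ring of fractions is needed. -/
def HasTrivialMultipliers (n : Λ) (K : Ideal Λ) : Prop :=
  ∀ b, (∀ k ∈ K, ∃ k' ∈ K, k * b = k' * n) → b ∈ Ideal.span {n}

theorem mul_le_span_of_mul_mul_le (hn : ∀ x, Commute n x) (hK : HasTrivialMultipliers n K)
    (hI : ∀ b, (∀ x ∈ I, x * b ∈ Ideal.span {n}) → b ∈ Ideal.span {n})
    {J : Ideal Λ} (h : K * (I * J) ≤ Ideal.span {n}) : J * K ≤ Ideal.span {n} := by
  refine Ideal.mul_le.2 fun c hc k hk => hI _ fun x hx => hK _ fun k₀ hk₀ => ?_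
  obtain ⟨y, hy⟩ := Ideal.mem_span_singleton'.1
    (h (Ideal.mul_mem_mul hk₀ (Ideal.mul_mem_mul hx hc)))
  refine ⟨y * k, K.mul_mem_left y hk, ?_⟩
  rw [mul_assoc y, ← (hn k).eq, ← mul_assoc y, hy]
  simp only [mul_assoc]

theorem pow_succ_le_span_of_mul_pow_le [I.IsTwoSided] [K.IsTwoSided]
    (hn : ∀ x, Commute n x) (hK : HasTrivialMultipliers n K)
    (hI : ∀ b, (∀ x ∈ I, x * b ∈ Ideal.span {n}) → b ∈ Ideal.span {n}) (j b : ℕ)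
    (h : K * ((I * K) ^ j * K ^ b) ≤ Ideal.span {n}) : K ^ (b + j + 1) ≤ Ideal.span {n} := by
  induction j generalizing b with
  | zero =>
    rw [Submodule.pow_zero, Submodule.one_mul] at h
    rwa [Ideal.IsTwoSided.pow_succ]
  | succ j ih =>
    rw [Ideal.IsTwoSided.pow_succ] at h
    have h' : K * (I * (K * ((I * K) ^ j * K ^ b))) ≤ Ideal.span {n} := by
      simpa only [mul_assoc] using h
    rw [show b + (j + 1) = b + 1 + j by ring]
    refine ih (b + 1) ?_
    rw [Ideal.IsTwoSided.pow_add, Submodule.pow_one]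
    simpa only [mul_assoc] using mul_le_span_of_mul_mul_le hn hK hI h'

theorem eq_top_of_forall_mul_mem_span [I.IsTwoSided] [(Ideal.span {n}).IsTwoSided]
    [IsSemiprimaryRing (Λ ⧸ Ideal.span {n})] (hn : ∀ x, Commute n x) (hnI : n ∈ I)
    (hclosed : ∀ K : Ideal Λ, K.IsTwoSided → n ∈ K → HasTrivialMultipliers n K)
    (hI : ∀ b, (∀ x ∈ I, x * b ∈ Ideal.span {n}) → b ∈ Ideal.span {n}) : I = ⊤ := by
  obtain ⟨K, hK, hle, hsup, m, hm⟩ := exists_isTwoSided_sup_eq_top_mul_pow_le I (Ideal.span {n})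
  have hnK : n ∈ K := hle (Ideal.mem_span_singleton_self n)
  have hpow : K ^ (0 + m + 1) ≤ Ideal.span {n} := by
    refine pow_succ_le_span_of_mul_pow_le hn (hclosed K hK hnK) hI m 0 ?_
    rw [Submodule.pow_zero, Ideal.IsTwoSided.mul_one]
    exact Ideal.mul_le_right.trans hm
  rw [← Ideal.sup_pow_eq_top (n := 0 + m + 1) hsup, left_eq_sup]
  exact hpow.trans ((Ideal.span_singleton_le_iff_mem I).2 hnI)

end Multipliers

end Ideals

section Arithmetic

theorem inv_den_mem (R : Subring ℚ) {x : ℚ} (hx : x ∈ R) : (x.den : ℚ)⁻¹ ∈ R := by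
  obtain ⟨a, b, hab⟩ := Rat.isCoprime_num_den x
  have hden : (x.den : ℚ) ≠ 0 := by exact_mod_cast x.den_ne_zero
  have hinv : (x.den : ℚ)⁻¹ = a * x + b := by
    have h : (a : ℚ) * x.num + b * x.den = 1 := by exact_mod_cast hab
    field_simp
    rw [← h, ← Rat.mul_den_eq_num x]
    ring
  rw [hinv]
  exact R.add_mem (R.mul_mem (intCast_mem R a) hx) (intCast_mem R b)

theorem isPrincipalIdealRing_subring_rat (R : Subring ℚ) : IsPrincipalIdealRing R := by
  refine ⟨fun I => ?_⟩
  obtain ⟨d, hd⟩ := (IsPrincipalIdealRing.principal (I.comap (Int.castRingHom R))).principal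
  have hdI : (d : R) ∈ I := by
    have : d ∈ I.comap (Int.castRingHom R) := hd ▸ Submodule.mem_span_singleton_self d
    simpa only [Ideal.mem_comap, eq_intCast] using this
  refine ⟨(d : R), le_antisymm (fun x hx => ?_) ((Ideal.span_singleton_le_iff_mem I).2 hdI)⟩
  have hnum : ((x : ℚ).num : R) = ((x : ℚ).den : R) * x := Subtype.ext (by simp)
  have hxnum : (x : ℚ).num ∈ I.comap (Int.castRingHom R) := by
    rw [Ideal.mem_comap, eq_intCast, hnum]
    exact I.mul_mem_left _ hx
  rw [hd] at hxnum
  obtain ⟨c, hc⟩ := Ideal.mem_span_singleton'.1 hxnum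
  refine Ideal.mem_span_singleton'.2 ⟨⟨_, inv_den_mem R x.2⟩ * (c : R), Subtype.ext ?_⟩
  have hc' : (c : ℚ) * d = (x : ℚ).num := by exact_mod_cast hc
  push_cast
  rw [mul_assoc, hc', mul_comm, ← div_eq_mul_inv, Rat.num_div_den]

theorem isArtinianRing_quotient_span_singleton {R Λ : Type*} [CommRing R]
    [IsDomain R] [IsPrincipalIdealRing R] [Ring Λ] [Algebra R Λ] [Module.Finite R Λ] {r : R}
    (hr : r ≠ 0) {x : Λ} (hx : algebraMap R Λ r = x) [(Ideal.span {x}).IsTwoSided] :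
    IsArtinianRing (Λ ⧸ Ideal.span {x}) := by
  have : IsArtinianRing (R ⧸ Ideal.span {r}) := isArtinian_of_tower R
    (isFiniteLength_iff_isNoetherian_isArtinian.1
      (isFiniteLength_quotient_span_singleton R (mem_nonZeroDivisors_of_ne_zero hr))).2
  let Q := Λ ⧸ Ideal.span {x}
  have htors : Module.IsTorsionBySet R Q (Ideal.span {r} : Set R) := by
    rw [Module.isTorsionBySet_span_singleton_iff]
    intro q
    obtain ⟨y, rfl⟩ := Ideal.Quotient.mk_surjective q
    refine Ideal.Quotient.eq_zero_iff_mem.2 (?_ : r • y ∈ _)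
    rw [Algebra.smul_def, Algebra.commutes, hx]
    exact Ideal.mul_mem_left _ _ (Ideal.mem_span_singleton_self _)
  let _ : Module (R ⧸ Ideal.span {r}) Q := htors.module
  have : IsScalarTower R (R ⧸ Ideal.span {r}) Q := htors.isScalarTower
  have : Module.Finite (R ⧸ Ideal.span {r}) Q := Module.Finite.of_restrictScalars_finite R _ _
  have hQ : IsArtinian R Q := isArtinian_of_surjective_algebraMap (S := R)
    (R := R ⧸ Ideal.span {r}) Ideal.Quotient.mk_surjective
  exact isArtinian_of_tower R hQ

end Arithmetic

section RightMultipliers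

variable {R A : Type*} [CommRing R] [Ring A] [Algebra R A]

/-- The inclusion of `B` in `A`. -/
def SubRingWithOne.subtype (B : SubRingWithOne R A) : B.Elt →ₗ[R] A := B.toSubmodule.subtype

/-- `I` is a two-sided ideal of the ring `B`, as a submodule of the ambient ring `A`. -/
structure SubRingWithOne.IsIdeal (B : SubRingWithOne R A) (I : Submodule R A) : Prop where
  le : I ≤ B.toSubmodule
  mul_mem_left : ∀ {b x : A}, b ∈ B.toSubmodule → x ∈ I → b * x ∈ I
  mul_mem_right : ∀ {x b : A}, x ∈ I → b ∈ B.toSubmodule → x * b ∈ I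

/-- The elements of `u A u`, for an idempotent `u`, which multiply `K` into itself from the
right. If `K` is a lattice, this is its right order. -/
def rightMultipliers (u : A) (K : Submodule R A) : Submodule R A where
  carrier := {a | u * a = a ∧ a * u = a ∧ ∀ k ∈ K, k * a ∈ K}
  zero_mem' := ⟨mul_zero u, zero_mul u, fun k _ => by simp⟩
  add_mem' := by
    rintro a b ⟨hua, hau, ha⟩ ⟨hub, hbu, hb⟩
    refine ⟨by rw [mul_add, hua, hub], by rw [add_mul, hau, hbu], fun k hk => ?_⟩
    rw [mul_add]
    exact K.add_mem (ha k hk) (hb k hk)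
  smul_mem' := by
    rintro r a ⟨hua, hau, ha⟩
    refine ⟨by rw [mul_smul_comm, hua], by rw [smul_mul_assoc, hau], fun k hk => ?_⟩
    rw [mul_smul_comm]
    exact K.smul_mem r (ha k hk)

/-- The right order of every two-sided ideal of `B` containing a nonzero integer is `B`: this is
the only property of maximal orders that is needed. -/
def SubRingWithOne.IsMultiplierClosed (B : SubRingWithOne R A) : Prop :=
  ∀ K, B.IsIdeal K → ∀ n : ℕ, n ≠ 0 → n • B.one' ∈ K →
    rightMultipliers B.one' K ≤ B.toSubmodule

variable {B : SubRingWithOne R A}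

theorem SubRingWithOne.coe_natCast (n : ℕ) : (n : B.Elt).1 = n • B.one' := by
  rw [← nsmul_one]
  exact map_nsmul B.subtype n (1 : B.Elt)

theorem SubRingWithOne.IsIdeal.le_rightMultipliers {I : Submodule R A} (hI : B.IsIdeal I) :
    B.toSubmodule ≤ rightMultipliers B.one' I :=
  fun _ ha => ⟨B.one_mul' ha, B.mul_one' ha, fun _ hk => hI.mul_mem_right hk ha⟩

/-- The ideal `I`, as an ideal of the type `B.Elt`. -/
def SubRingWithOne.IsIdeal.toIdeal {I : Submodule R A} (hI : B.IsIdeal I) : Ideal B.Elt where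
  carrier := {x | x.1 ∈ I}
  zero_mem' := I.zero_mem
  add_mem' hx hy := I.add_mem hx hy
  smul_mem' c _ hx := hI.mul_mem_left c.2 hx

instance SubRingWithOne.IsIdeal.isTwoSided_toIdeal {I : Submodule R A} (hI : B.IsIdeal I) :
    hI.toIdeal.IsTwoSided :=
  ⟨fun y hx => hI.mul_mem_right hx y.2⟩

theorem SubRingWithOne.isIdeal_map_subtype (K : Ideal B.Elt) [K.IsTwoSided] :
    B.IsIdeal ((K.restrictScalars R).map B.subtype) where
  le := by
    rintro _ ⟨k, -, rfl⟩
    exact k.2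
  mul_mem_left := by
    rintro b _ hb ⟨k, hk, rfl⟩
    exact ⟨⟨b, hb⟩ * k, K.mul_mem_left _ hk, rfl⟩
  mul_mem_right := by
    rintro _ b ⟨k, hk, rfl⟩ hb
    exact ⟨k * ⟨b, hb⟩, K.mul_mem_right _ hk, rfl⟩

end RightMultipliers

section Orders

variable {R : Subring ℚ} {A : Type*} [Ring A] [Algebra ℚ A]

theorem fg_of_le {M : Type*} [AddCommGroup M] [Module R M] {N N' : Submodule R M} (hN : N.FG)
    (h : N' ≤ N) : N'.FG := by
  have := isPrincipalIdealRing_subring_rat R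
  exact isNoetherian_submodule.1 (isNoetherian_of_fg_of_noetherian N hN) N' h

theorem inv_smul_nsmul {M : Type*} [AddCommGroup M] [Module ℚ M] {n : ℕ} (hn : n ≠ 0) (a : M) :
    (n : ℚ)⁻¹ • n • a = a := by
  rw [← Nat.cast_smul_eq_nsmul ℚ, smul_smul, inv_mul_cancel₀ (by exact_mod_cast hn), one_smul]

theorem nsmul_inv_smul {M : Type*} [AddCommGroup M] [Module ℚ M] {n : ℕ} (hn : n ≠ 0) (a : M) :
    n • (n : ℚ)⁻¹ • a = a := by
  rw [smul_comm, inv_smul_nsmul hn]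

theorem isOrder_rightMultipliers {u : A} {L K : Submodule R A} (hL : IsOrder R u L)
    (hle : L ≤ rightMultipliers u K) (hK : K ≤ L) {n : ℕ} (hn : n ≠ 0) (hnK : n • u ∈ K) :
    IsOrder R u (rightMultipliers u K) where
  one_mem := hle hL.one_mem
  mul_mem := by
    rintro a ⟨hua, -, ha⟩ b ⟨-, hbu, hb⟩
    refine ⟨by rw [← mul_assoc, hua], by rw [mul_assoc, hbu], fun k hk => ?_⟩
    rw [← mul_assoc]
    exact hb _ (ha k hk)
  one_mul _ ha := ha.1
  mul_one _ ha := ha.2.1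
  fg := by
    refine fg_of_le (hL.fg.map (LinearMap.mulLeft R ((n : ℚ)⁻¹ • (1 : A)))) ?_
    rintro a ⟨hua, -, ha⟩
    refine ⟨n • u * a, hK (ha _ hnK), ?_⟩
    rw [LinearMap.mulLeft_apply, smul_mul_assoc n, hua, smul_mul_assoc, one_mul,
      inv_smul_nsmul hn]
  span x := Submodule.span_mono hle (hL.span x)

theorem IsMaximalOrder.isMultiplierClosed {B : SubRingWithOne R A}
    (hB : IsMaximalOrder R B.one' B.toSubmodule) : B.IsMultiplierClosed := by
  intro K hK n hn hnK
  exact (hB.2 _ (isOrder_rightMultipliers hB.1 hK.le_rightMultipliers hK.le hn hnK)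
    hK.le_rightMultipliers).le

variable {B : SubRingWithOne R A}

theorem SubRingWithOne.mem_span_natCast_iff {n : ℕ} (hn : n ≠ 0) (b : B.Elt) :
    b ∈ Ideal.span {(n : B.Elt)} ↔ (n : ℚ)⁻¹ • b.1 ∈ B.toSubmodule := by
  have hcoe : ∀ c : B.Elt, (c * (n : B.Elt)).1 = n • c.1 := fun c => by
    change c.1 * (n : B.Elt).1 = _
    rw [B.coe_natCast, mul_smul_comm, B.mul_one' c.2]
  rw [Ideal.mem_span_singleton']
  constructor
  · rintro ⟨c, rfl⟩
    rw [hcoe, inv_smul_nsmul hn]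
    exact c.2
  · intro hb
    exact ⟨⟨_, hb⟩, Subtype.ext ((hcoe _).trans (nsmul_inv_smul hn b.1))⟩

theorem SubRingWithOne.one_mul_smul (q : ℚ) (b : B.Elt) : B.one' * (q • b.1) = q • b.1 := by
  rw [mul_smul_comm, B.one_mul' b.2]

theorem SubRingWithOne.smul_mul_one (q : ℚ) (b : B.Elt) : q • b.1 * B.one' = q • b.1 := by
  rw [smul_mul_assoc, B.mul_one' b.2]

theorem SubRingWithOne.IsMultiplierClosed.hasTrivialMultipliers (hB : B.IsMultiplierClosed)
    {n : ℕ} (hn : n ≠ 0) (K : Ideal B.Elt) [K.IsTwoSided] (hnK : (n : B.Elt) ∈ K) :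
    HasTrivialMultipliers (n : B.Elt) K := by
  intro b hb
  refine (B.mem_span_natCast_iff hn b).2
    (hB _ (B.isIdeal_map_subtype K) n hn ⟨_, hnK, B.coe_natCast n⟩ ?_)
  refine ⟨B.one_mul_smul _ b, B.smul_mul_one _ b, ?_⟩
  rintro _ ⟨k, hk, rfl⟩
  obtain ⟨k', hk', hkb⟩ := hb k hk
  have hkb' : k.1 * b.1 = n • k'.1 := by
    rw [← B.mul_one' k'.2, ← mul_smul_comm, ← B.coe_natCast]
    exact congrArg Subtype.val hkb
  refine ⟨k', hk', ?_⟩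
  change k'.1 = k.1 * _
  rw [mul_smul_comm, hkb', inv_smul_nsmul hn]

theorem SubRingWithOne.IsMultiplierClosed.one_mem (hB : B.IsMultiplierClosed)
    (hfg : B.toSubmodule.FG) {I : Submodule R A} (hI : B.IsIdeal I) {n : ℕ} (hn : n ≠ 0)
    (hnI : n • B.one' ∈ I)
    (hrefl : ∀ a, B.one' * a = a → a * B.one' = a → (∀ x ∈ I, x * a ∈ B.toSubmodule) →
      ∀ x ∈ I, x * a ∈ I) : B.one' ∈ I := by
  have := isPrincipalIdealRing_subring_rat R
  have : Module.Finite R B.Elt := Module.Finite.iff_fg.2 hfg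
  have hcomm : ∀ x : B.Elt, Commute (n : B.Elt) x := Nat.cast_commute n
  have : (Ideal.span {(n : B.Elt)}).IsTwoSided := isTwoSided_span_singleton hcomm
  have : IsArtinianRing (B.Elt ⧸ Ideal.span {(n : B.Elt)}) :=
    isArtinianRing_quotient_span_singleton (R := R) (Nat.cast_ne_zero.2 hn) (map_natCast _ n)
  suffices hI.toIdeal = ⊤ from (this ▸ Submodule.mem_top : (1 : B.Elt) ∈ hI.toIdeal)
  have hnJ : (n : B.Elt) ∈ hI.toIdeal := by
    change (n : B.Elt).1 ∈ I
    rwa [B.coe_natCast]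
  refine eq_top_of_forall_mul_mem_span hcomm hnJ
    (fun K _ hnK => hB.hasTrivialMultipliers hn K hnK) fun b hb => ?_
  refine (B.mem_span_natCast_iff hn b).2 (hB _ hI n hn hnI
    ⟨B.one_mul_smul _ b, B.smul_mul_one _ b,
      hrefl _ (B.one_mul_smul _ b) (B.smul_mul_one _ b) fun x hx => ?_⟩)
  rw [mul_smul_comm]
  exact (B.mem_span_natCast_iff hn _).1 (hb ⟨x, hI.le hx⟩ hx)

theorem SubRingWithOne.IsMultiplierClosed.one_mem_of_le_mul_self (hB : B.IsMultiplierClosed)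
    (hfg : B.toSubmodule.FG) {I : Submodule R A} (hI : B.IsIdeal I) (hidem : I ≤ I * I) {n : ℕ}
    (hn : n ≠ 0) (hnI : n • B.one' ∈ I) : B.one' ∈ I := by
  refine hB.one_mem hfg hI hn hnI fun a _ _ ha x hx => ?_
  refine Submodule.mul_induction_on (hidem hx) (fun y hy z hz => ?_) fun y z hy hz => ?_
  · rw [mul_assoc]
    exact hI.mul_mem_right hy (ha z hz)
  · rw [add_mul]
    exact I.add_mem hy hz

end Orders

section MoritaContext

namespace SubBimodule

variable {R A : Type*} [CommRing R] [Ring A] [Algebra R A] {B C : SubRingWithOne R A}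

theorem mul_left_le (P : SubBimodule B C) : B.toSubmodule * P.toSubmodule ≤ P.toSubmodule :=
  Submodule.mul_le.2 fun _ hb _ hx => P.left_mem' hb hx

theorem mul_right_le (P : SubBimodule B C) : P.toSubmodule * C.toSubmodule ≤ P.toSubmodule :=
  Submodule.mul_le.2 fun _ hx _ hc => P.right_mem' hx hc

variable {P : SubBimodule B C} {Q : SubBimodule C B}

theorem isIdeal_mul_mul (hPQ : P.toSubmodule * Q.toSubmodule ≤ B.toSubmodule)
    {K : Submodule R A} (hK : K ≤ C.toSubmodule) :
    B.IsIdeal (P.toSubmodule * K * Q.toSubmodule) where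
  le := (mul_le_mul_left ((mul_le_mul_right hK _).trans P.mul_right_le) _).trans hPQ
  mul_mem_left hb hx := by
    refine mul_le_mul_left (mul_le_mul_left P.mul_left_le K) Q.toSubmodule ?_
    simpa only [mul_assoc] using Submodule.mul_mem_mul hb hx
  mul_mem_right hx hb := by
    refine mul_le_mul_right Q.mul_right_le (P.toSubmodule * K) ?_
    simpa only [mul_assoc] using Submodule.mul_mem_mul hx hb

theorem nsmul_mem_mul_mul {K : Submodule R A} {n : ℕ} (hn : n • C.one' ∈ K) {x : A}
    (hx : x ∈ P.toSubmodule * Q.toSubmodule) :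
    n • x ∈ P.toSubmodule * K * Q.toSubmodule := by
  refine Submodule.mul_induction_on hx (fun p hp q hq => ?_) fun x y hx hy => ?_
  · rw [← P.one_right' hp, ← smul_mul_assoc, ← mul_smul_comm]
    exact Submodule.mul_mem_mul (Submodule.mul_mem_mul hp hn) hq
  · rw [smul_add]
    exact add_mem hx hy

theorem mul_mul_mem_rightMultipliers (hQP : Q.toSubmodule * P.toSubmodule ≤ C.toSubmodule)
    {K : Submodule R A} (hK : C.IsIdeal K) {a p q : A} (ha : a ∈ rightMultipliers C.one' K)
    (hp : p ∈ P.toSubmodule) (hq : q ∈ Q.toSubmodule) :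
    p * a * q ∈ rightMultipliers B.one' (P.toSubmodule * K * Q.toSubmodule) := by
  refine ⟨?_, ?_, fun x hx => ?_⟩
  · rw [← mul_assoc, ← mul_assoc, P.one_left' hp]
  · rw [mul_assoc, Q.one_right' hq]
  · refine Submodule.mul_induction_on hx (fun y hy q' hq' => ?_) fun x y hx hy => ?_
    · refine Submodule.mul_induction_on hy (fun p' hp' k hk => ?_) fun x y hx hy => ?_
      · have hka : k * (q' * p) * a ∈ K :=
          ha.2.2 _ (hK.mul_mem_right hk (hQP (Submodule.mul_mem_mul hq' hp)))
        simpa only [mul_assoc] using Submodule.mul_mem_mul (Submodule.mul_mem_mul hp' hka) hq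
      · rw [add_mul, add_mul]
        exact add_mem hx hy
    · rw [add_mul]
      exact add_mem hx hy

theorem isMultiplierClosed_right (hB : B.IsMultiplierClosed)
    (hPQ : P.toSubmodule * Q.toSubmodule = B.toSubmodule)
    (hQP : Q.toSubmodule * P.toSubmodule ≤ C.toSubmodule)
    (hrefl : ∀ a, C.one' * a = a → a * C.one' = a →
      (∀ p ∈ P.toSubmodule, ∀ q ∈ Q.toSubmodule, p * a * q ∈ B.toSubmodule) →
        a ∈ C.toSubmodule) : C.IsMultiplierClosed := by
  intro K hK n hn hnK a ha
  refine hrefl a ha.1 ha.2.1 fun p hp q hq => ?_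
  exact hB _ (isIdeal_mul_mul hPQ.le hK.le) n hn
    (nsmul_mem_mul_mul hnK (hPQ.ge B.one_mem')) (mul_mul_mem_rightMultipliers hQP hK ha hp hq)

theorem isIdeal_mul (hPQ : P.toSubmodule * Q.toSubmodule ≤ B.toSubmodule) :
    B.IsIdeal (P.toSubmodule * Q.toSubmodule) where
  le := hPQ
  mul_mem_left hb hx := by
    refine mul_le_mul_left P.mul_left_le Q.toSubmodule ?_
    simpa only [mul_assoc] using Submodule.mul_mem_mul hb hx
  mul_mem_right hx hb := by
    refine mul_le_mul_right Q.mul_right_le P.toSubmodule ?_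
    simpa only [mul_assoc] using Submodule.mul_mem_mul hx hb

theorem mul_le_mul_mul_self (hB : B.one' ∈ P.toSubmodule * Q.toSubmodule) :
    Q.toSubmodule * P.toSubmodule ≤
      Q.toSubmodule * P.toSubmodule * (Q.toSubmodule * P.toSubmodule) := by
  refine Submodule.mul_le.2 fun q hq p hp => ?_
  rw [← Q.one_right' hq]
  simpa only [mul_assoc] using Submodule.mul_mem_mul (Submodule.mul_mem_mul hq hB) hp

end SubBimodule

variable {R : Subring ℚ} {A : Type*} [Ring A] [Algebra ℚ A] {B C : SubRingWithOne R A}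
  {P : SubBimodule B C} {Q : SubBimodule C B}

theorem SubBimodule.one_mem_mul (hB : B.IsMultiplierClosed) (hC : C.toSubmodule.FG)
    (hPQ : P.toSubmodule * Q.toSubmodule = B.toSubmodule)
    (hQP : Q.toSubmodule * P.toSubmodule ≤ C.toSubmodule) {n : ℕ} (hn : n ≠ 0)
    (hnQP : n • C.one' ∈ Q.toSubmodule * P.toSubmodule)
    (hrefl : ∀ a, C.one' * a = a → a * C.one' = a →
      (∀ p ∈ P.toSubmodule, ∀ q ∈ Q.toSubmodule, p * a * q ∈ B.toSubmodule) →
        a ∈ C.toSubmodule) : C.one' ∈ Q.toSubmodule * P.toSubmodule :=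
  (isMultiplierClosed_right hB hPQ hQP hrefl).one_mem_of_le_mul_self hC (isIdeal_mul hQP)
    (mul_le_mul_mul_self (hPQ.ge B.one_mem')) hn hnQP

end MoritaContext

section GroupRing

variable {Γ : Type u} [Group Γ]

theorem sum_coeff_smul_of [Fintype Γ] (x : MonoidAlgebra ℚ Γ) :
    ∑ γ, x.coeff γ • MonoidAlgebra.of ℚ Γ γ = x := by
  conv_rhs => rw [← MonoidAlgebra.sum_coeff_single x]
  rw [Finsupp.sum_fintype _ _ (by simp)]
  simp

theorem of_mem_groupRing (R : Subring ℚ) (γ : Γ) : MonoidAlgebra.of ℚ Γ γ ∈ groupRing R Γ :=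
  Submodule.subset_span ⟨γ, rfl⟩

theorem mem_groupRing_iff [Finite Γ] {R : Subring ℚ} {x : MonoidAlgebra ℚ Γ} :
    x ∈ groupRing R Γ ↔ ∀ γ, x.coeff γ ∈ R := by
  classical
  have := Fintype.ofFinite Γ
  constructor
  · intro hx γ
    induction hx using Submodule.span_induction with
    | mem x hx =>
      obtain ⟨δ, rfl⟩ := hx
      rw [MonoidAlgebra.of_apply, MonoidAlgebra.coeff_single, Finsupp.single_apply]
      split_ifs
      exacts [R.one_mem, R.zero_mem]
    | zero => exact R.zero_mem
    | add x y _ _ hx hy => exact R.add_mem hx hy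
    | smul r x _ hx => exact R.mul_mem r.2 hx
  · intro h
    rw [← sum_coeff_smul_of x]
    exact Submodule.sum_mem _ fun γ _ =>
      (groupRing R Γ).smul_mem ⟨_, h γ⟩ (of_mem_groupRing R γ)

theorem mul_mem_groupRing {R : Subring ℚ} {x y : MonoidAlgebra ℚ Γ}
    (hx : x ∈ groupRing R Γ) (hy : y ∈ groupRing R Γ) : x * y ∈ groupRing R Γ := by
  have h : groupRing R Γ * groupRing R Γ ≤ groupRing R Γ := by
    rw [groupRing, Submodule.span_mul_span, Submodule.span_le]
    rintro _ ⟨_, ⟨γ, rfl⟩, _, ⟨δ, rfl⟩, rfl⟩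
    exact Submodule.subset_span ⟨γ * δ, map_mul _ _ _⟩
  exact h (Submodule.mul_mem_mul hx hy)

theorem mem_groupRing_zS [Finite Γ] {S : Set Nat.Primes} {x : MonoidAlgebra ℚ Γ}
    (h : ∀ p ∈ S, x ∈ groupRing (zS {p}) Γ) : x ∈ groupRing (zS S) Γ :=
  mem_groupRing_iff.2 fun γ p hp => mem_groupRing_iff.1 (h p hp) γ p rfl

theorem sum_eq_sum_quotient_sum {M : Type*} [AddCommMonoid M] [Fintype Γ] (Γ' : Subgroup Γ)
    [Fintype Γ'] [Fintype (Γ ⧸ Γ')] (f : Γ → M) :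
    ∑ γ, f γ = ∑ q : Γ ⧸ Γ', ∑ τ : Γ', f (q.out * τ) := by
  rw [← Fintype.sum_prod_type' fun (q : Γ ⧸ Γ') (τ : Γ') => f (q.out * τ)]
  refine (Function.Bijective.sum_comp (e := fun p : (Γ ⧸ Γ') × Γ' => p.1.out * (p.2 : Γ))
    ⟨?_, fun γ => ?_⟩ f).symm
  · rintro ⟨q, τ⟩ ⟨q', τ'⟩ h
    obtain rfl : q = q' := by simpa using congrArg (QuotientGroup.mk (s := Γ')) h
    simpa using h
  · obtain ⟨τ, hτ⟩ := QuotientGroup.mk_out_eq_mul Γ' γ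
    exact ⟨(γ, τ⁻¹), by simp [hτ]⟩

end GroupRing

section TrivialIdempotent

variable {Γ : Type u} [Group Γ] [Finite Γ] (Γ' : Subgroup Γ)

theorem card_smul_trivIdem [Fintype Γ'] :
    Nat.card Γ' • trivIdem Γ' = ∑ τ : Γ', MonoidAlgebra.of ℚ Γ (τ : Γ) := by
  rw [trivIdem, finsum_eq_sum_of_fintype, nsmul_inv_smul Nat.card_pos.ne']

theorem card_smul_trivIdem_mem (R : Subring ℚ) : Nat.card Γ' • trivIdem Γ' ∈ groupRing R Γ := by
  have := Fintype.ofFinite Γ'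
  rw [card_smul_trivIdem]
  exact Submodule.sum_mem _ fun τ _ => of_mem_groupRing R _

theorem trivIdem_mul_eq_iff {x : MonoidAlgebra ℚ Γ} :
    trivIdem Γ' * x = x ↔ ∀ τ ∈ Γ', MonoidAlgebra.of ℚ Γ τ * x = x := by
  refine ⟨fun h τ hτ => ?_, trivIdem_mul Γ'⟩
  rw [← h, ← mul_assoc, of_mul_trivIdem Γ' ⟨τ, hτ⟩]

theorem trivIdem_mul_of (τ : Γ') :
    trivIdem Γ' * MonoidAlgebra.of ℚ Γ (τ : Γ) = trivIdem Γ' := by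
  have := Fintype.ofFinite Γ'
  rw [trivIdem, finsum_eq_sum_of_fintype, smul_mul_assoc, Finset.sum_mul]
  congr 1
  refine Fintype.sum_equiv (Equiv.mulRight τ) _ _ fun σ => ?_
  simp [MonoidAlgebra.single_mul_single]

variable {Γ'}

theorem coeff_mul_of_mul_trivIdem_eq_self {x : MonoidAlgebra ℚ Γ} (hx : x * trivIdem Γ' = x)
    (γ : Γ) (τ : Γ') : x.coeff (γ * τ) = x.coeff γ := by
  have h : x * MonoidAlgebra.of ℚ Γ (τ : Γ) = x := by
    rw [← hx, mul_assoc, trivIdem_mul_of]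
  conv_lhs => rw [← h]
  rw [MonoidAlgebra.of_apply, MonoidAlgebra.coeff_mul_single_apply, mul_one, mul_inv_cancel_right]

theorem sum_coeff_mul_eq_zero [Fintype Γ'] {x : MonoidAlgebra ℚ Γ} (hx : x * trivIdem Γ' = 0)
    (γ : Γ) : ∑ τ : Γ', x.coeff (γ * τ) = 0 := by
  have h : x * (Nat.card Γ' • trivIdem Γ') = 0 := by rw [mul_smul_comm, hx, smul_zero]
  rw [card_smul_trivIdem, Finset.mul_sum] at h
  calc ∑ τ : Γ', x.coeff (γ * τ)
      = ∑ τ : Γ', (x * MonoidAlgebra.of ℚ Γ (τ : Γ)).coeff γ := by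
        refine Fintype.sum_equiv (Equiv.inv Γ') _ _ fun τ => ?_
        rw [MonoidAlgebra.of_apply, MonoidAlgebra.coeff_mul_single_apply]
        simp
    _ = (∑ τ : Γ', x * MonoidAlgebra.of ℚ Γ (τ : Γ)).coeff γ := by
        rw [MonoidAlgebra.coeff_sum, Finsupp.finsetSum_apply]
    _ = 0 := by rw [h, MonoidAlgebra.coeff_zero, Finsupp.zero_apply]

theorem exists_eq_mul_trivIdem {R : Subring ℚ} {x : MonoidAlgebra ℚ Γ}
    (hx : x * trivIdem Γ' = x) (hR : Nat.card Γ' • x ∈ groupRing R Γ) :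
    ∃ z ∈ groupRing R Γ, x = z * trivIdem Γ' := by
  classical
  have := Fintype.ofFinite Γ
  have hcoset : ∀ (γ : Γ) (τ : Γ'),
      x.coeff (γ * τ) • MonoidAlgebra.of ℚ Γ (γ * τ) * trivIdem Γ' =
        x.coeff γ • MonoidAlgebra.of ℚ Γ γ * trivIdem Γ' := by
    intro γ τ
    rw [coeff_mul_of_mul_trivIdem_eq_self hx, map_mul, smul_mul_assoc, mul_assoc, of_mul_trivIdem,
      smul_mul_assoc]
  refine ⟨∑ q : Γ ⧸ Γ', (Nat.card Γ' • x).coeff q.out • MonoidAlgebra.of ℚ Γ q.out,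
    Submodule.sum_mem _ fun q _ => (groupRing R Γ).smul_mem
      ⟨_, mem_groupRing_iff.1 hR q.out⟩ (of_mem_groupRing R _), ?_⟩
  conv_lhs => rw [← hx, ← sum_coeff_smul_of x]
  simp only [sum_eq_sum_quotient_sum Γ', Finset.sum_mul, hcoset, Finset.sum_const,
    Finset.card_univ, ← Nat.card_eq_fintype_card, MonoidAlgebra.coeff_smul, Finsupp.smul_apply,
    smul_assoc, smul_mul_assoc]

end TrivialIdempotent

section AugmentationIdempotent

variable {Γ : Type u} [Group Γ] (Γ' : Subgroup Γ)

theorem exists_asAlgebraHom_single_eq (w : MonoidAlgebra ℚ (Γ ⧸ Γ')) :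
    ∃ x : MonoidAlgebra ℚ Γ, (Representation.ofMulAction ℚ Γ (Γ ⧸ Γ')).asAlgebraHom x
      (MonoidAlgebra.single ((1 : Γ) : Γ ⧸ Γ') 1) = w := by
  induction w using MonoidAlgebra.induction_linear with
  | zero => exact ⟨0, by simp⟩
  | add v w hv hw =>
    obtain ⟨x, rfl⟩ := hv
    obtain ⟨y, rfl⟩ := hw
    exact ⟨x + y, by simp⟩
  | single q c =>
    refine ⟨c • MonoidAlgebra.of ℚ Γ q.out, ?_⟩
    have hq : q.out • ((1 : Γ) : Γ ⧸ Γ') = q := by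
      rw [MulAction.Quotient.smul_coe, smul_eq_mul, mul_one, QuotientGroup.out_eq']
    rw [map_smul, LinearMap.smul_apply, Representation.asAlgebraHom_of,
      Representation.ofMulAction_single, MonoidAlgebra.smul_single, smul_eq_mul, mul_one, hq]

variable [Finite Γ]

theorem asAlgebraHom_trivIdem_single_one :
    (Representation.ofMulAction ℚ Γ (Γ ⧸ Γ')).asAlgebraHom (trivIdem Γ')
      (MonoidAlgebra.single ((1 : Γ) : Γ ⧸ Γ') 1) = MonoidAlgebra.single ((1 : Γ) : Γ ⧸ Γ') 1 := by
  have := Fintype.ofFinite Γ'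
  have hfix : ∀ τ : Γ', (Representation.ofMulAction ℚ Γ (Γ ⧸ Γ')).asAlgebraHom
      (MonoidAlgebra.of ℚ Γ (τ : Γ)) (MonoidAlgebra.single ((1 : Γ) : Γ ⧸ Γ') 1) =
        MonoidAlgebra.single ((1 : Γ) : Γ ⧸ Γ') 1 := by
    intro τ
    have hτ : (τ : Γ) • ((1 : Γ) : Γ ⧸ Γ') = ((1 : Γ) : Γ ⧸ Γ') := by
      rw [MulAction.Quotient.smul_coe, smul_eq_mul, mul_one, QuotientGroup.eq]
      simp
    rw [Representation.asAlgebraHom_of, Representation.ofMulAction_single, hτ]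
  rw [trivIdem, finsum_eq_sum_of_fintype, map_smul, map_sum, LinearMap.smul_apply,
    LinearMap.sum_apply, Finset.sum_congr rfl fun τ _ => hfix τ, Finset.sum_const,
    Finset.card_univ, ← Nat.card_eq_fintype_card, inv_smul_nsmul Nat.card_pos.ne']

theorem augIdem_mem_of_mul_trivIdem_mem (I : Ideal (MonoidAlgebra ℚ Γ)) [I.IsTwoSided]
    (h : augIdem Γ' * trivIdem Γ' ∈ I) : augIdem Γ' ∈ I := by
  obtain ⟨f, hf, hcentral, hone⟩ := exists_central_one_of_isTwoSided I
  have hacts : ActsAsOne Γ' f := by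
    intro w hw
    obtain ⟨x, hx⟩ := exists_asAlgebraHom_single_eq Γ' w
    have hgen : (Representation.ofMulAction ℚ Γ (Γ ⧸ Γ')).asAlgebraHom
        (x * (augIdem Γ' * trivIdem Γ')) (MonoidAlgebra.single ((1 : Γ) : Γ ⧸ Γ') 1) = w := by
      rw [← mul_assoc, ← (augIdem_spec Γ').central, mul_assoc, map_mul, map_mul,
        Module.End.mul_apply, Module.End.mul_apply, asAlgebraHom_trivIdem_single_one, hx,
        (augIdem_spec Γ').acts w hw]
    conv_lhs => rw [← hgen]
    rw [← Module.End.mul_apply, ← map_mul, hone _ (I.mul_mem_left x h), hgen]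
  rw [← (augIdem_spec Γ').minimal f (hone f hf) hcentral hacts]
  exact I.mul_mem_left _ hf

theorem augIdem_mul_trivIdem_comm : augIdem Γ' * trivIdem Γ' = trivIdem Γ' * augIdem Γ' :=
  (augIdem_spec Γ').central _

theorem augIdem_mul_trivIdem_idem :
    augIdem Γ' * trivIdem Γ' * (augIdem Γ' * trivIdem Γ') = augIdem Γ' * trivIdem Γ' := by
  conv_lhs => rw [mul_assoc, ← mul_assoc (trivIdem Γ'), ← augIdem_mul_trivIdem_comm, mul_assoc,
    trivIdem_idem, ← mul_assoc, (augIdem_spec Γ').idem]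

end AugmentationIdempotent

section RationalSpan

variable {R : Subring ℚ} {A : Type*} [Ring A] [Algebra ℚ A]

theorem exists_nsmul_mem_of_mem_span {M : Submodule R A} {x : A}
    (hx : x ∈ Submodule.span ℚ (M : Set A)) : ∃ n : ℕ, n ≠ 0 ∧ n • x ∈ M := by
  induction hx using Submodule.span_induction with
  | mem x hx => exact ⟨1, one_ne_zero, by rwa [one_smul]⟩
  | zero => exact ⟨1, one_ne_zero, by rw [smul_zero]; exact M.zero_mem⟩
  | add x y _ _ hx hy =>
    obtain ⟨n, hn, hx⟩ := hx
    obtain ⟨m, hm, hy⟩ := hy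
    refine ⟨n * m, mul_ne_zero hn hm, ?_⟩
    rw [smul_add, mul_comm n m, mul_smul, mul_comm m n, mul_smul]
    exact M.add_mem (M.smul_of_tower_mem m hx) (M.smul_of_tower_mem n hy)
  | smul q x _ hx =>
    obtain ⟨n, hn, hx⟩ := hx
    refine ⟨q.den * n, mul_ne_zero q.den_ne_zero hn, ?_⟩
    have hq : (q.den * n) • q • x = q.num • n • x := by
      rw [mul_comm, mul_smul, ← Nat.cast_smul_eq_nsmul ℚ q.den, smul_smul, Rat.den_mul_eq_num,
        Int.cast_smul_eq_zsmul, smul_comm]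
    rw [hq]
    exact M.smul_of_tower_mem _ hx

theorem mul_mem_span_of_mul_mem {M N K : Submodule R A} (h : ∀ x ∈ M, ∀ y ∈ N, x * y ∈ K) {x y : A}
    (hx : x ∈ Submodule.span ℚ (M : Set A)) (hy : y ∈ Submodule.span ℚ (N : Set A)) :
    x * y ∈ Submodule.span ℚ (K : Set A) := by
  have hxy := Submodule.mul_mem_mul hx hy
  rw [Submodule.span_mul_span] at hxy
  exact Submodule.span_mono (Set.mul_subset_iff.2 h) hxy

variable {B : SubRingWithOne R A} {I : Submodule R A}

/-- The `ℚ`-span of an ideal `I` of the order `B`, as a left ideal of the ambient algebra. -/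
def SubRingWithOne.IsIdeal.ratSpan (hI : B.IsIdeal I) (hB : IsOrder R B.one' B.toSubmodule)
    (hcentral : ∀ x, Commute B.one' x) : Ideal A where
  __ := (Submodule.span ℚ (I : Set A)).toAddSubmonoid
  smul_mem' a x hx := by
    have hax : a * x = B.one' * a * B.one' * x := by
      have hone : B.one' * x = x := LinearMap.eqOn_span (f := LinearMap.mulLeft ℚ B.one')
        (g := LinearMap.id) (fun y hy => B.one_mul' (hI.le hy)) hx
      rw [hcentral a, mul_assoc, mul_assoc, hone, hone]
    change a * x ∈ Submodule.span ℚ (I : Set A)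
    rw [hax]
    exact mul_mem_span_of_mul_mem (fun _ hb _ => hI.mul_mem_left hb) (hB.span a) hx

instance SubRingWithOne.IsIdeal.isTwoSided_ratSpan (hI : B.IsIdeal I)
    (hB : IsOrder R B.one' B.toSubmodule) (hcentral : ∀ x, Commute B.one' x) :
    (hI.ratSpan hB hcentral).IsTwoSided where
  mul_mem_of_left {x} a hx := by
    have hxa : x * a = x * (B.one' * a * B.one') := by
      have hone : x * B.one' = x := LinearMap.eqOn_span (f := LinearMap.mulRight ℚ B.one')
        (g := LinearMap.id) (fun y hy => B.mul_one' (hI.le hy)) hx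
      rw [mul_assoc, ← mul_assoc x, hone, ← hcentral a, ← mul_assoc, hone]
    change x * a ∈ Submodule.span ℚ (I : Set A)
    rw [hxa]
    exact mul_mem_span_of_mul_mem (fun _ hy _ => hI.mul_mem_right hy) hx (hB.span a)

end RationalSpan

section GoodPrimes

theorem IsOrder.span_of_le {R R' : Subring ℚ} (hRR' : R ≤ R') {A : Type*} [Ring A] [Algebra ℚ A]
    {u : A} {L : Submodule R A} (hL : IsOrder R u L) :
    IsOrder R' u (Submodule.span R' (L : Set A)) where
  one_mem := Submodule.subset_span hL.one_mem
  mul_mem x hx y hy := by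
    have hxy := Submodule.mul_mem_mul hx hy
    rw [Submodule.span_mul_span] at hxy
    exact Submodule.span_mono (Set.mul_subset_iff.2 hL.mul_mem) hxy
  one_mul _ hx := LinearMap.eqOn_span (f := LinearMap.mulLeft R' u) (g := LinearMap.id)
    hL.one_mul hx
  mul_one _ hx := LinearMap.eqOn_span (f := LinearMap.mulRight R' u) (g := LinearMap.id)
    hL.mul_one hx
  fg := by
    obtain ⟨t, rfl⟩ := hL.fg
    let : Algebra R R' := (Subring.inclusion hRR').toAlgebra
    have : IsScalarTower R R' A := ⟨fun r s a => smul_assoc (r : ℚ) (s : ℚ) a⟩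
    exact ⟨t, (Submodule.span_span_of_tower R R' (t : Set A)).symm⟩
  span x := Submodule.span_mono Submodule.subset_span (hL.span x)

variable {Γ : Type u} [Group Γ] [Finite Γ]

theorem le_map_groupRing_of_isGoodPrime {S : Set Nat.Primes} {e : MonoidAlgebra ℚ Γ}
    (hgood : ∀ p ∈ S, IsGoodPrime p e) {L : Submodule (zS S) (MonoidAlgebra ℚ Γ)}
    (hL : IsOrder (zS S) e L) (h : (groupRing (zS S) Γ).map (LinearMap.mulLeft (zS S) e) ≤ L) :
    L ≤ (groupRing (zS S) Γ).map (LinearMap.mulLeft (zS S) e) := by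
  intro x hx
  refine ⟨x, mem_groupRing_zS fun p hp => ?_, hL.one_mul x hx⟩
  have hle : zS S ≤ zS {p} := by
    rintro q hq _ rfl
    exact hq _ hp
  obtain ⟨he, hmax⟩ := hgood p hp
  have hLp : Submodule.span (zS {p}) (L : Set (MonoidAlgebra ℚ Γ)) =
      (groupRing (zS {p}) Γ).map (LinearMap.mulLeft (zS {p}) e) := by
    refine hmax.2 _ (hL.span_of_le hle) ?_
    rw [groupRing, Submodule.map_span, Submodule.span_le]
    rintro _ ⟨_, ⟨γ, rfl⟩, rfl⟩
    exact Submodule.subset_span (h ⟨_, of_mem_groupRing _ γ, rfl⟩)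
  obtain ⟨y, hy, rfl⟩ := hLp.le (Submodule.subset_span hx)
  exact mul_mem_groupRing he hy

variable {R : Subring ℚ} (Γ' : Subgroup Γ)

theorem eO_toSubmodule (O : Subalgebra R (MonoidAlgebra ℚ Γ)) :
    (eO Γ' O).toSubmodule =
      (Subalgebra.toSubmodule O).map (LinearMap.mulLeft R (augIdem Γ')) := by
  ext a
  exact ⟨fun ⟨x, hx, h⟩ => ⟨x, hx, h.symm⟩, fun ⟨x, hx, h⟩ => ⟨x, hx, h.symm⟩⟩

theorem isOrder_eO {O : Subalgebra R (MonoidAlgebra ℚ Γ)}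
    (hO : IsOrder R 1 (Subalgebra.toSubmodule O)) :
    IsOrder R (augIdem Γ') (eO Γ' O).toSubmodule where
  one_mem := (eO Γ' O).one_mem'
  mul_mem _ hx _ hy := (eO Γ' O).mul_mem' hx hy
  one_mul _ hx := (eO Γ' O).one_mul' hx
  mul_one _ hx := (eO Γ' O).mul_one' hx
  fg := by
    rw [eO_toSubmodule]
    exact hO.fg.map _
  span x := by
    have hx : x ∈ Submodule.span ℚ (Subalgebra.toSubmodule O : Set (MonoidAlgebra ℚ Γ)) := by
      simpa only [one_mul, mul_one] using hO.span x
    have hle : Submodule.span ℚ (Subalgebra.toSubmodule O : Set (MonoidAlgebra ℚ Γ)) ≤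
        (Submodule.span ℚ ((eO Γ' O).toSubmodule : Set (MonoidAlgebra ℚ Γ))).comap
          (LinearMap.mulLeft ℚ (augIdem Γ')) :=
      Submodule.span_le.2 fun y hy => Submodule.subset_span ⟨y, hy, rfl⟩
    rw [mul_assoc, ← (augIdem_spec Γ').central, ← mul_assoc, (augIdem_spec Γ').idem]
    exact hle hx

variable {S : Set Nat.Primes} {O : Subalgebra (zS S) (MonoidAlgebra ℚ Γ)}

theorem eO_le_groupRing (hgood : ∀ p ∈ S, IsGoodPrime p (augIdem Γ'))
    (hO : IsOrder (zS S) 1 (Subalgebra.toSubmodule O))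
    (hΓ : groupRing (zS S) Γ ≤ Subalgebra.toSubmodule O) :
    (eO Γ' O).toSubmodule ≤ groupRing (zS S) Γ := by
  have hle := le_map_groupRing_of_isGoodPrime hgood (isOrder_eO Γ' hO) (by
    rw [eO_toSubmodule]
    exact Submodule.map_mono hΓ)
  refine hle.trans ?_
  rintro _ ⟨y, hy, rfl⟩
  exact mul_mem_groupRing (mem_groupRing_zS fun p hp => (hgood p hp).1) hy

theorem isMaximalOrder_eO (hgood : ∀ p ∈ S, IsGoodPrime p (augIdem Γ'))
    (hO : IsOrder (zS S) 1 (Subalgebra.toSubmodule O))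
    (hΓ : groupRing (zS S) Γ ≤ Subalgebra.toSubmodule O) :
    IsMaximalOrder (zS S) (augIdem Γ') (eO Γ' O).toSubmodule := by
  have hle : (groupRing (zS S) Γ).map (LinearMap.mulLeft (zS S) (augIdem Γ')) ≤
      (eO Γ' O).toSubmodule := by
    rw [eO_toSubmodule]
    exact Submodule.map_mono hΓ
  refine ⟨isOrder_eO Γ' hO, fun L hL hLe => le_antisymm ?_ hLe⟩
  exact (le_map_groupRing_of_isGoodPrime hgood hL (hle.trans hLe)).trans hle

end GoodPrimes

section TraceIdeals

variable {Γ : Type u} [Group Γ] [Finite Γ] (Γ' : Subgroup Γ) {R : Subring ℚ}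
  {O : Subalgebra R (MonoidAlgebra ℚ Γ)}

theorem mem_leftInv_iff {x : MonoidAlgebra ℚ Γ} :
    x ∈ (leftInv Γ' O).toSubmodule ↔ x ∈ (eO Γ' O).toSubmodule ∧ trivIdem Γ' * x = x :=
  and_congr_right fun _ => (trivIdem_mul_eq_iff Γ').symm

theorem mem_heckeOrder_iff {x : MonoidAlgebra ℚ Γ} :
    x ∈ (heckeOrder Γ' O).toSubmodule ↔
      x ∈ (rightProj Γ' O).toSubmodule ∧ trivIdem Γ' * x = x :=
  and_congr_right fun _ => (trivIdem_mul_eq_iff Γ').symm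

theorem rightProj_toSubmodule :
    (rightProj Γ' O).toSubmodule =
      (eO Γ' O).toSubmodule.map (LinearMap.mulRight R (trivIdem Γ')) := by
  ext a
  exact ⟨fun ⟨x, hx, h⟩ => ⟨x, hx, h.symm⟩, fun ⟨x, hx, h⟩ => ⟨x, hx, h.symm⟩⟩

theorem fg_heckeOrder (hO : IsOrder R 1 (Subalgebra.toSubmodule O)) :
    (heckeOrder Γ' O).toSubmodule.FG := by
  have hle : (heckeOrder Γ' O).toSubmodule ≤ (rightProj Γ' O).toSubmodule := fun _ hx => hx.1
  refine fg_of_le ?_ hle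
  rw [rightProj_toSubmodule]
  exact (isOrder_eO Γ' hO).fg.map _

theorem rightProj_mul_leftInv_le :
    (rightProj Γ' O).toSubmodule * (leftInv Γ' O).toSubmodule ≤ (eO Γ' O).toSubmodule := by
  rw [Submodule.mul_le]
  rintro _ ⟨y, hy, rfl⟩ q hq
  rw [mem_leftInv_iff] at hq
  rw [mul_assoc, hq.2]
  exact (eO Γ' O).mul_mem' hy hq.1

theorem leftInv_mul_rightProj_le :
    (leftInv Γ' O).toSubmodule * (rightProj Γ' O).toSubmodule ≤ (heckeOrder Γ' O).toSubmodule := by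
  rw [Submodule.mul_le]
  rintro q hq _ ⟨y, hy, rfl⟩
  rw [mem_leftInv_iff] at hq
  rw [mem_heckeOrder_iff]
  refine ⟨⟨q * y, (eO Γ' O).mul_mem' hq.1 hy, (mul_assoc _ _ _).symm⟩, ?_⟩
  rw [← mul_assoc, hq.2]

theorem augIdem_mul_trivIdem_mem_rightProj :
    augIdem Γ' * trivIdem Γ' ∈ (rightProj Γ' O).toSubmodule :=
  ⟨_, (eO Γ' O).one_mem', rfl⟩

theorem card_smul_mem_leftInv (hΓ : groupRing R Γ ≤ Subalgebra.toSubmodule O) :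
    Nat.card Γ' • (augIdem Γ' * trivIdem Γ') ∈ (leftInv Γ' O).toSubmodule := by
  rw [mem_leftInv_iff]
  refine ⟨⟨_, hΓ (card_smul_trivIdem_mem Γ' R), (mul_smul_comm _ _ _).symm⟩, ?_⟩
  rw [mul_smul_comm, ← mul_assoc, ← augIdem_mul_trivIdem_comm, mul_assoc, trivIdem_idem]

theorem card_smul_mem_rightProj_mul_leftInv (hΓ : groupRing R Γ ≤ Subalgebra.toSubmodule O) :
    Nat.card Γ' • (augIdem Γ' * trivIdem Γ') ∈
      (rightProj Γ' O).toSubmodule * (leftInv Γ' O).toSubmodule := by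
  have h := Submodule.mul_mem_mul (augIdem_mul_trivIdem_mem_rightProj Γ' (O := O))
    (card_smul_mem_leftInv Γ' hΓ)
  rwa [mul_smul_comm, augIdem_mul_trivIdem_idem] at h

theorem card_smul_mem_leftInv_mul_rightProj (hΓ : groupRing R Γ ≤ Subalgebra.toSubmodule O) :
    Nat.card Γ' • (augIdem Γ' * trivIdem Γ') ∈
      (leftInv Γ' O).toSubmodule * (rightProj Γ' O).toSubmodule := by
  have h := Submodule.mul_mem_mul (card_smul_mem_leftInv Γ' hΓ)
    (augIdem_mul_trivIdem_mem_rightProj Γ' (O := O))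
  rwa [smul_mul_assoc, augIdem_mul_trivIdem_idem] at h

theorem exists_nsmul_augIdem_mem (hO : IsOrder R 1 (Subalgebra.toSubmodule O))
    {I : Submodule R (MonoidAlgebra ℚ Γ)} (hI : (eO Γ' O).IsIdeal I) {m : ℕ} (hm : m ≠ 0)
    (h : m • (augIdem Γ' * trivIdem Γ') ∈ I) : ∃ n : ℕ, n ≠ 0 ∧ n • augIdem Γ' ∈ I := by
  have horder : IsOrder R (eO Γ' O).one' (eO Γ' O).toSubmodule := isOrder_eO Γ' hO
  have hcentral : ∀ x, Commute (eO Γ' O).one' x := (augIdem_spec Γ').central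
  refine exists_nsmul_mem_of_mem_span
    (augIdem_mem_of_mul_trivIdem_mem Γ' (hI.ratSpan horder hcentral) ?_)
  change _ ∈ Submodule.span ℚ (I : Set (MonoidAlgebra ℚ Γ))
  rw [← inv_smul_nsmul hm (augIdem Γ' * trivIdem Γ')]
  exact Submodule.smul_mem _ _ (Submodule.subset_span h)

theorem mul_mem_leftInv_of_forall_mul_mem {a : MonoidAlgebra ℚ Γ}
    (ha : ∀ x ∈ (rightProj Γ' O).toSubmodule * (leftInv Γ' O).toSubmodule,
      x * a ∈ (eO Γ' O).toSubmodule) {q : MonoidAlgebra ℚ Γ}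
    (hq : q ∈ (leftInv Γ' O).toSubmodule) : q * a ∈ (leftInv Γ' O).toSubmodule := by
  have h := ha _ (Submodule.mul_mem_mul (augIdem_mul_trivIdem_mem_rightProj Γ') hq)
  rw [show augIdem Γ' * trivIdem Γ' * q = q from (leftInv Γ' O).one_left' hq] at h
  exact (mem_leftInv_iff Γ').2 ⟨h, by rw [← mul_assoc, ((mem_leftInv_iff Γ').1 hq).2]⟩

theorem rightProj_mul_leftInv_eq (hO : IsOrder R 1 (Subalgebra.toSubmodule O))
    (hΓ : groupRing R Γ ≤ Subalgebra.toSubmodule O) (hmax : (eO Γ' O).IsMultiplierClosed) :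
    (rightProj Γ' O).toSubmodule * (leftInv Γ' O).toSubmodule = (eO Γ' O).toSubmodule := by
  have hideal := SubBimodule.isIdeal_mul (rightProj_mul_leftInv_le Γ' (O := O))
  refine le_antisymm hideal.le fun b hb => ?_
  suffices hone : augIdem Γ' ∈ (rightProj Γ' O).toSubmodule * (leftInv Γ' O).toSubmodule by
    rw [← (eO Γ' O).mul_one' hb]
    exact hideal.mul_mem_left hb hone
  obtain ⟨n, hn, hnI⟩ := exists_nsmul_augIdem_mem Γ' hO hideal Nat.card_pos.ne'
    (card_smul_mem_rightProj_mul_leftInv Γ' hΓ)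
  refine hmax.one_mem (isOrder_eO Γ' hO).fg hideal hn hnI fun a _ _ ha x hx => ?_
  refine Submodule.mul_induction_on hx (fun p hp q hq => ?_) fun y z hy hz => ?_
  · rw [mul_assoc]
    exact Submodule.mul_mem_mul hp (mul_mem_leftInv_of_forall_mul_mem Γ' ha hq)
  · rw [add_mul]
    exact add_mem hy hz

variable {S : Set Nat.Primes} {O : Subalgebra (zS S) (MonoidAlgebra ℚ Γ)}
  (hgood : ∀ p ∈ S, IsGoodPrime p (augIdem Γ'))
  (hO : IsOrder (zS S) 1 (Subalgebra.toSubmodule O))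
  (hΓ : groupRing (zS S) Γ ≤ Subalgebra.toSubmodule O)

include hgood hO hΓ

theorem mem_heckeOrder_of_card_smul_mem_eO {a : MonoidAlgebra ℚ Γ}
    (hεa : augIdem Γ' * trivIdem Γ' * a = a) (haε : a * (augIdem Γ' * trivIdem Γ') = a)
    (ha : Nat.card Γ' • a ∈ (eO Γ' O).toSubmodule) : a ∈ (heckeOrder Γ' O).toSubmodule := by
  have hea : augIdem Γ' * a = a := by
    rw [← hεa, ← mul_assoc, ← mul_assoc, (augIdem_spec Γ').idem]
  have hae : a * trivIdem Γ' = a := by rw [← haε, mul_assoc, mul_assoc, trivIdem_idem]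
  have hta : trivIdem Γ' * a = a := by
    rw [← hεa, augIdem_mul_trivIdem_comm, ← mul_assoc, ← mul_assoc, trivIdem_idem]
  obtain ⟨z, hz, rfl⟩ := exists_eq_mul_trivIdem hae (eO_le_groupRing Γ' hgood hO hΓ ha)
  refine (mem_heckeOrder_iff Γ').2 ⟨⟨augIdem Γ' * z, ⟨z, hΓ hz, rfl⟩, ?_⟩, hta⟩
  rw [mul_assoc, hea]

theorem one_mem_leftInv_mul_rightProj : (heckeOrder Γ' O).one' ∈
    (leftInv Γ' O).toSubmodule * (rightProj Γ' O).toSubmodule := by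
  have hmax : (eO Γ' O).IsMultiplierClosed :=
    (isMaximalOrder_eO Γ' hgood hO hΓ).isMultiplierClosed
  refine SubBimodule.one_mem_mul hmax (fg_heckeOrder Γ' hO)
    (rightProj_mul_leftInv_eq Γ' hO hΓ hmax) (leftInv_mul_rightProj_le Γ') Nat.card_pos.ne'
    (card_smul_mem_leftInv_mul_rightProj Γ' hΓ) fun a hεa haε h => ?_
  have hcard := h _ (augIdem_mul_trivIdem_mem_rightProj Γ') _ (card_smul_mem_leftInv Γ' hΓ)
  rw [show augIdem Γ' * trivIdem Γ' * a = a from hεa, mul_smul_comm,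
    show a * (augIdem Γ' * trivIdem Γ') = a from haε] at hcard
  exact mem_heckeOrder_of_card_smul_mem_eO Γ' hgood hO hΓ hεa haε hcard

end TraceIdeals

section Lift

namespace BTensor

variable {T R M N K : Type*} [Ring T] [Ring R] [AddCommGroup M] [Module T M] [Module Rᵐᵒᵖ M]
  [AddCommGroup N] [Module R N] [AddCommGroup K]

theorem smul_btmul (t : T) (m : M) (n : N) : t • btmul T R m n = btmul T R (t • m) n := by
  rw [btmul, ← map_smul, TensorProduct.smul_tmul']
  rfl

theorem op_smul_btmul (r : R) (m : M) (n : N) :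
    btmul T R (MulOpposite.op r • m) n = btmul T R m (r • n) :=
  (Submodule.Quotient.eq _).2 (Submodule.subset_span ⟨m, r, n, rfl⟩)

variable (T R N) in
/-- The map `n ↦ m ⊗ n`. -/
def mk (m : M) : N →+ BTensor T R M N :=
  (tensorRel T R M N).mkQ.toAddMonoidHom.comp (TensorProduct.mk ℤ M N m).toAddMonoidHom

theorem mk_apply (m : M) (n : N) : mk T R N m n = btmul T R m n := rfl

@[ext]
theorem addHom_ext {f g : BTensor T R M N →+ K}
    (h : ∀ m, f.comp (mk T R N m) = g.comp (mk T R N m)) : f = g := by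
  ext x
  obtain ⟨x, rfl⟩ := Submodule.mkQ_surjective _ x
  induction x using TensorProduct.induction_on with
  | zero => rw [map_zero, map_zero, map_zero]
  | tmul m n => exact DFunLike.congr_fun (h m) n
  | add x y hx hy => rw [map_add, map_add, map_add, hx, hy]

variable [SMulCommClass T Rᵐᵒᵖ M]

/-- The additive map on `M ⊗_R N` induced by a biadditive map which is balanced over `R`. -/
def liftAddHom (f : M →+ N →+ K)
    (hf : ∀ (r : R) m n, f (MulOpposite.op r • m) n = f m (r • n)) : BTensor T R M N →+ K :=
  QuotientAddGroup.lift (tensorRel T R M N).toAddSubgroup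
    (TensorProduct.liftAddHom f fun z m n => by simp) (by
      intro x hx
      rw [AddMonoidHom.mem_ker]
      induction hx using Submodule.closure_induction with
      | zero => rw [map_zero]
      | add x y _ _ hx hy => rw [map_add, hx, hy, add_zero]
      | smul_mem t x hx =>
        obtain ⟨m, r, n, rfl⟩ := hx
        rw [smul_sub, TensorProduct.smul_tmul', TensorProduct.smul_tmul', map_sub,
          TensorProduct.liftAddHom_tmul, TensorProduct.liftAddHom_tmul, smul_comm, hf, sub_self])

/-- The `T`-linear map on `M ⊗_R N` induced by a biadditive map which is balanced over `R` and
`T`-linear in the first variable. -/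
def lift [Module T K] (f : M →+ N →+ K)
    (hf : ∀ (r : R) m n, f (MulOpposite.op r • m) n = f m (r • n))
    (hsmul : ∀ (t : T) m n, f (t • m) n = t • f m n) : BTensor T R M N →ₗ[T] K where
  __ := liftAddHom f hf
  map_smul' t x := by
    have h : (liftAddHom f hf : BTensor T R M N →+ K).comp
        (DistribSMul.toAddMonoidHom (BTensor T R M N) t) =
          (DistribSMul.toAddMonoidHom K t).comp (liftAddHom f hf) := by
      ext m n
      exact hsmul t m n
    exact DFunLike.congr_fun h x

end BTensor

end Lift

section Morita

open BTensor

namespace SubBimodule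

variable {R : Type*} {A : Type u} [CommRing R] [Ring A] [Algebra R A] {B C : SubRingWithOne R A}
  (P : SubBimodule B C) (Q : SubBimodule C B)

/-- Multiplication `P × Q → B` in the ambient ring. -/
def mul (hPQ : P.toSubmodule * Q.toSubmodule ≤ B.toSubmodule) : P.Elt →+ Q.Elt →+ B.Elt :=
  AddMonoidHom.mk' (fun p => AddMonoidHom.mk'
    (fun q => ⟨p.1 * q.1, hPQ (Submodule.mul_mem_mul p.2 q.2)⟩)
    fun q q' => Subtype.ext (mul_add p.1 q.1 q'.1))
    fun p p' => AddMonoidHom.ext fun q => Subtype.ext (add_mul p.1 p'.1 q.1)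

variable {P Q} (hPQ : P.toSubmodule * Q.toSubmodule ≤ B.toSubmodule)

theorem smul_mul (b : B.Elt) (p : P.Elt) (q : Q.Elt) :
    P.mul Q hPQ (b • p) q = b * P.mul Q hPQ p q :=
  Subtype.ext (mul_assoc _ _ _)

theorem op_smul_mul (c : C.Elt) (p : P.Elt) (q : Q.Elt) :
    P.mul Q hPQ (MulOpposite.op c • p) q = P.mul Q hPQ p (c • q) :=
  Subtype.ext (mul_assoc _ _ _)

theorem mul_op_smul (p : P.Elt) (b : B.Elt) (q : Q.Elt) :
    P.mul Q hPQ p (MulOpposite.op b • q) = P.mul Q hPQ p q * b :=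
  Subtype.ext (mul_assoc _ _ _).symm

theorem mul_smul_eq_op_mul_smul (hQP : Q.toSubmodule * P.toSubmodule ≤ C.toSubmodule) (p : P.Elt)
    (q : Q.Elt) (p' : P.Elt) :
    P.mul Q hPQ p q • p' = MulOpposite.op (Q.mul P hQP q p') • p :=
  Subtype.ext (mul_assoc _ _ _)

variable {X : Type*} [AddCommGroup X] [Module B.Elt X]

theorem mem_of_forall_mul_smul_mem (hone : B.one' ∈ P.toSubmodule * Q.toSubmodule)
    (Z : AddSubgroup X) {x : X} (h : ∀ p q, P.mul Q hPQ p q • x ∈ Z) : x ∈ Z := by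
  obtain ⟨b, hb, hbx⟩ : ∃ b : B.Elt, b.1 = B.one' ∧ b • x ∈ Z := by
    refine Submodule.mul_induction_on hone (fun p hp q hq => ⟨_, rfl, h ⟨p, hp⟩ ⟨q, hq⟩⟩) ?_
    rintro _ _ ⟨b, rfl, hb⟩ ⟨c, rfl, hc⟩
    exact ⟨b + c, rfl, by rw [add_smul]; exact Z.add_mem hb hc⟩
  obtain rfl : b = 1 := Subtype.ext hb
  rwa [one_smul] at hbx

variable (X) in
/-- The map `Q ⊗_B X → X` given by `q ⊗ x ↦ (p q) x`, for `p ∈ P`. -/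
def mulSMul (p : P.Elt) : BTensor C.Elt B.Elt Q.Elt X →+ X :=
  liftAddHom ((Module.toAddMonoidEnd B.Elt X).toAddMonoidHom.comp (P.mul Q hPQ p)) fun b q x => by
    change P.mul Q hPQ p (MulOpposite.op b • q) • x = P.mul Q hPQ p q • b • x
    rw [mul_op_smul, mul_smul]

theorem mulSMul_btmul (p : P.Elt) (q : Q.Elt) (x : X) :
    mulSMul hPQ X p (btmul C.Elt B.Elt q x) = P.mul Q hPQ p q • x := rfl

variable (X) in
/-- The map `P ⊗_C (Q ⊗_B X) → X` given by `p ⊗ (q ⊗ x) ↦ (p q) x`. -/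
def eval : BTensor B.Elt C.Elt P.Elt (BTensor C.Elt B.Elt Q.Elt X) →ₗ[B.Elt] X :=
  lift
    (AddMonoidHom.mk' (mulSMul hPQ X) fun p p' => by
      ext q x
      change P.mul Q hPQ (p + p') q • x = P.mul Q hPQ p q • x + P.mul Q hPQ p' q • x
      rw [map_add, AddMonoidHom.add_apply, add_smul])
    (fun c p y => by
      have h : mulSMul hPQ X (MulOpposite.op c • p) =
          (mulSMul hPQ X p).comp (DistribSMul.toAddMonoidHom _ c) := by
        ext q x
        change P.mul Q hPQ (MulOpposite.op c • p) q • x =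
          mulSMul hPQ X p (c • btmul C.Elt B.Elt q x)
        rw [smul_btmul, mulSMul_btmul, op_smul_mul]
      exact DFunLike.congr_fun h y)
    (fun b p y => by
      have h : mulSMul hPQ X (b • p) = (DistribSMul.toAddMonoidHom X b).comp (mulSMul hPQ X p) := by
        ext q x
        change P.mul Q hPQ (b • p) q • x = b • P.mul Q hPQ p q • x
        rw [smul_mul, mul_smul]
      exact DFunLike.congr_fun h y)

theorem eval_btmul (p : P.Elt) (q : Q.Elt) (x : X) :
    eval hPQ X (btmul B.Elt C.Elt p (btmul C.Elt B.Elt q x)) = P.mul Q hPQ p q • x := rfl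

theorem mul_smul_eq_btmul_eval (hQP : Q.toSubmodule * P.toSubmodule ≤ C.toSubmodule) (p : P.Elt)
    (q : Q.Elt) (y : BTensor B.Elt C.Elt P.Elt (BTensor C.Elt B.Elt Q.Elt X)) :
    P.mul Q hPQ p q • y = btmul B.Elt C.Elt p (btmul C.Elt B.Elt q (eval hPQ X y)) := by
  have h : DistribSMul.toAddMonoidHom _ (P.mul Q hPQ p q) =
      (BTensor.mk B.Elt C.Elt _ p).comp
        ((BTensor.mk C.Elt B.Elt X q).comp (eval hPQ X).toAddMonoidHom) := by
    ext p' q' x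
    change P.mul Q hPQ p q • btmul B.Elt C.Elt p' (btmul C.Elt B.Elt q' x) =
      btmul B.Elt C.Elt p (btmul C.Elt B.Elt q (P.mul Q hPQ p' q' • x))
    rw [smul_btmul, mul_smul_eq_op_mul_smul hPQ hQP, op_smul_btmul, smul_btmul,
      mul_smul_eq_op_mul_smul hQP hPQ, op_smul_btmul]
  exact DFunLike.congr_fun h y

theorem eval_bijective (hQP : Q.toSubmodule * P.toSubmodule ≤ C.toSubmodule)
    (hone : B.one' ∈ P.toSubmodule * Q.toSubmodule) : Function.Bijective (eval hPQ X) := by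
  constructor
  · rw [injective_iff_map_eq_zero]
    intro y hy
    refine AddSubgroup.mem_bot.1 (mem_of_forall_mul_smul_mem hPQ hone ⊥ fun p q => ?_)
    rw [AddSubgroup.mem_bot, mul_smul_eq_btmul_eval hPQ hQP, hy,
      ← BTensor.mk_apply q, map_zero, ← BTensor.mk_apply p, map_zero]
  · intro x
    exact mem_of_forall_mul_smul_mem hPQ hone (eval hPQ X).range.toAddSubgroup
      fun p q => ⟨_, eval_btmul hPQ p q x⟩

theorem eval_btensorMap {X' : Type*} [AddCommGroup X'] [Module B.Elt X'] (f : X →ₗ[B.Elt] X')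
    (y : BTensor B.Elt C.Elt P.Elt (BTensor C.Elt B.Elt Q.Elt X)) :
    eval hPQ X' (btensorMap _ _ _ (btensorMap _ _ _ f) y) = f (eval hPQ X y) := by
  have h : (eval hPQ X').toAddMonoidHom.comp
      (btensorMap B.Elt C.Elt P.Elt (btensorMap C.Elt B.Elt Q.Elt f)).toAddMonoidHom =
        f.toAddMonoidHom.comp (eval hPQ X).toAddMonoidHom := by
    ext p q x
    exact (map_smul f (P.mul Q hPQ p q) x).symm
  exact DFunLike.congr_fun h y

/-- The natural isomorphism `P ⊗_C (Q ⊗_B -) ≅ 𝟭`. -/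
def tensorCompIso (hQP : Q.toSubmodule * P.toSubmodule ≤ C.toSubmodule)
    (hone : B.one' ∈ P.toSubmodule * Q.toSubmodule) :
    tensorFunctor.{u, v} C.Elt B.Elt Q.Elt ⋙ tensorFunctor.{u, v} B.Elt C.Elt P.Elt ≅
      𝟭 (ModuleCat.{max u v} B.Elt) :=
  NatIso.ofComponents
    (fun X => (LinearEquiv.ofBijective (eval hPQ X)
      (eval_bijective hPQ hQP hone)).toModuleIso)
    fun f => ModuleCat.hom_ext (LinearMap.ext (eval_btensorMap hPQ f.hom))

/-- The equivalence of categories given by bimodules `P` and `Q` with `P Q = B` and `Q P = C`. -/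
def equivalence (hQP : Q.toSubmodule * P.toSubmodule ≤ C.toSubmodule)
    (hB : B.one' ∈ P.toSubmodule * Q.toSubmodule) (hC : C.one' ∈ Q.toSubmodule * P.toSubmodule) :
    ModuleCat.{max u v} B.Elt ≌ ModuleCat.{max u v} C.Elt :=
  CategoryTheory.Equivalence.mk (tensorFunctor.{u, v} C.Elt B.Elt Q.Elt)
    (tensorFunctor.{u, v} B.Elt C.Elt P.Elt) (tensorCompIso hPQ hQP hB).symm
    (tensorCompIso hQP hPQ hC)

theorem algebraMap_smul_eq_op_algebraMap_smul (r : R) (p : P.Elt) :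
    algebraMap R B.Elt r • p = MulOpposite.op (algebraMap R C.Elt r) • p := by
  refine Subtype.ext ?_
  change (r • B.one') * p.1 = p.1 * (r • C.one')
  rw [mul_smul_comm, smul_mul_assoc, P.one_left' p.2, P.one_right' p.2]

open scoped ModuleCat.Algebra in
theorem tensorFunctor_linear (P : SubBimodule B C) :
    (tensorFunctor.{u, v} B.Elt C.Elt P.Elt).Linear R where
  map_smul {X X'} f r := by
    have h : (btensorMap B.Elt C.Elt P.Elt (r • f).hom).toAddMonoidHom =
        (DistribSMul.toAddMonoidHom _ (algebraMap R B.Elt r)).comp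
          (btensorMap B.Elt C.Elt P.Elt f.hom).toAddMonoidHom := by
      ext p x
      change btmul B.Elt C.Elt p (algebraMap R C.Elt r • f.hom x) =
        algebraMap R B.Elt r • btmul B.Elt C.Elt p (f.hom x)
      rw [smul_btmul, algebraMap_smul_eq_op_algebraMap_smul, op_smul_btmul]
    exact ModuleCat.hom_ext (LinearMap.ext fun y => DFunLike.congr_fun h y)

include hPQ in
theorem isMoritaEquivalent (hQP : Q.toSubmodule * P.toSubmodule ≤ C.toSubmodule)
    (hB : B.one' ∈ P.toSubmodule * Q.toSubmodule) (hC : C.one' ∈ Q.toSubmodule * P.toSubmodule) :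
    IsMoritaEquivalent R B.Elt C.Elt :=
  ⟨⟨⟨equivalence.{u, u} hPQ hQP hB hC, tensorFunctor_linear Q⟩⟩⟩

end SubBimodule

end Morita

section Invariants

variable {Γ : Type u} [Group Γ] [Finite Γ] (Γ' : Subgroup Γ) {R : Subring ℚ}
  {O : Subalgebra R (MonoidAlgebra ℚ Γ)} (hΓ : groupRing R Γ ≤ Subalgebra.toSubmodule O)

theorem groupElt_mul (γ δ : Γ) :
    groupElt Γ' hΓ (γ * δ) = groupElt Γ' hΓ γ * groupElt Γ' hΓ δ := by
  refine Subtype.ext ?_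
  change augIdem Γ' * MonoidAlgebra.of ℚ Γ (γ * δ) =
    augIdem Γ' * MonoidAlgebra.of ℚ Γ γ * (augIdem Γ' * MonoidAlgebra.of ℚ Γ δ)
  rw [← mul_assoc, ← (augIdem_spec Γ').central, ← mul_assoc, (augIdem_spec Γ').idem, map_mul,
    mul_assoc]

theorem groupElt_mul_eq_self {x : (eO Γ' O).Elt} {τ : Γ}
    (hx : MonoidAlgebra.of ℚ Γ τ * x.1 = x.1) : groupElt Γ' hΓ τ * x = x := by
  refine Subtype.ext ?_
  change augIdem Γ' * MonoidAlgebra.of ℚ Γ τ * x.1 = x.1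
  rw [mul_assoc, hx]
  exact (eO Γ' O).one_mul' x.2

theorem eq_sum_smul_groupElt [Fintype Γ] {σ : (eO Γ' O).Elt} (c : Γ → R)
    (hc : ∀ γ, (c γ : ℚ) = (show MonoidAlgebra ℚ Γ from σ.1).coeff γ) :
    σ = ∑ γ, c γ • groupElt Γ' hΓ γ := by
  refine Subtype.ext ?_
  calc σ.1 = augIdem Γ' * σ.1 := ((eO Γ' O).one_mul' σ.2).symm
    _ = augIdem Γ' * ∑ γ, (c γ : ℚ) • MonoidAlgebra.of ℚ Γ γ := by
      rw [Finset.sum_congr rfl fun γ _ => by rw [hc], sum_coeff_smul_of]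
    _ = ∑ γ, c γ • (augIdem Γ' * MonoidAlgebra.of ℚ Γ γ) := by
      rw [Finset.mul_sum]
      exact Finset.sum_congr rfl fun γ _ => mul_smul_comm _ _ _
    _ = (∑ γ, c γ • groupElt Γ' hΓ γ : (eO Γ' O).Elt).1 :=
      (map_sum (eO Γ' O).toSubmodule.subtype (fun γ => c γ • groupElt Γ' hΓ γ) Finset.univ).symm

variable {G : Type v} [AddCommGroup G] [Module (eO Γ' O).Elt G]

theorem incl_smul_mem_invariants (x : (leftInv Γ' O).Elt) (g : G) :
    leftInv.incl Γ' O x • g ∈ invariants Γ' hΓ G := fun τ hτ => by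
  rw [smul_smul, groupElt_mul_eq_self Γ' hΓ (x := leftInv.incl Γ' O x) (x.2.2 τ hτ)]

variable {Γ'}

theorem exists_eq_mul_trivIdem_of_mem_rightProj {a : MonoidAlgebra ℚ Γ}
    (ha : a ∈ (rightProj Γ' O).toSubmodule) :
    ∃ σ : (eO Γ' O).Elt, a = σ.1 * trivIdem Γ' :=
  let ⟨x, hx, h⟩ := ha
  ⟨⟨x, hx⟩, h⟩

section HeckeAction

variable {hΓ} (hle : (eO Γ' O).toSubmodule ≤ groupRing R Γ)
include hle

theorem smul_eq_zero_of_mul_trivIdem_eq_zero {σ : (eO Γ' O).Elt} (hσ : σ.1 * trivIdem Γ' = 0)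
    {g : G} (hg : g ∈ invariants Γ' hΓ G) : σ • g = 0 := by
  classical
  have := Fintype.ofFinite Γ
  let c : Γ → R := fun γ => ⟨_, mem_groupRing_iff.1 (hle σ.2) γ⟩
  rw [eq_sum_smul_groupElt Γ' hΓ (σ := σ) c fun γ => rfl, sum_eq_sum_quotient_sum Γ',
    Finset.sum_smul]
  refine Finset.sum_eq_zero fun q _ => ?_
  have hcoset : ∀ τ : Γ', (c (q.out * τ) • groupElt Γ' hΓ (q.out * τ)) • g =
      (c (q.out * τ) • (1 : (eO Γ' O).Elt)) • groupElt Γ' hΓ q.out • g := by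
    intro τ
    rw [← smul_one_mul (c _) (groupElt Γ' hΓ _), groupElt_mul, mul_smul, mul_smul, hg τ τ.2]
  have hsum : ∑ τ : Γ', c (q.out * τ) = 0 := by
    refine Subtype.ext ?_
    rw [AddSubmonoidClass.coe_finsetSum]
    exact sum_coeff_mul_eq_zero hσ q.out
  rw [Finset.sum_smul, Finset.sum_congr rfl fun τ _ => hcoset τ, ← Finset.sum_smul,
    ← Finset.sum_smul, hsum, zero_smul, zero_smul]

theorem smul_eq_smul_of_mul_trivIdem_eq {σ σ' : (eO Γ' O).Elt}
    (h : σ.1 * trivIdem Γ' = σ'.1 * trivIdem Γ') {g : G} (hg : g ∈ invariants Γ' hΓ G) :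
    σ • g = σ' • g := by
  rw [← sub_eq_zero, ← sub_smul]
  refine smul_eq_zero_of_mul_trivIdem_eq_zero hle ?_ hg
  change (σ.1 - σ'.1) * trivIdem Γ' = 0
  rw [sub_mul, h, sub_self]

theorem smul_mem_invariants {σ : (eO Γ' O).Elt}
    (h : σ.1 * trivIdem Γ' ∈ (heckeOrder Γ' O).toSubmodule) {g : G}
    (hg : g ∈ invariants Γ' hΓ G) : σ • g ∈ invariants Γ' hΓ G := by
  intro τ hτ
  rw [smul_smul]
  refine smul_eq_smul_of_mul_trivIdem_eq hle ?_ hg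
  change augIdem Γ' * MonoidAlgebra.of ℚ Γ τ * σ.1 * trivIdem Γ' = σ.1 * trivIdem Γ'
  rw [mul_assoc, mul_assoc, h.2 τ hτ]
  exact (rightProj Γ' O).one_left' h.1

/-- The element `σ g` of `^{Γ'}G`, where `a = σ e₁'` for some (arbitrarily chosen)
`σ ∈ e_{Γ/Γ'} O`. -/
def heckeSMul (a : (heckeOrder Γ' O).Elt) (g : invariants Γ' hΓ G) : invariants Γ' hΓ G :=
  ⟨(exists_eq_mul_trivIdem_of_mem_rightProj a.2.1).choose • g.1, smul_mem_invariants hle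
    ((exists_eq_mul_trivIdem_of_mem_rightProj a.2.1).choose_spec ▸ a.2) g.2⟩

theorem coe_heckeSMul {a : (heckeOrder Γ' O).Elt} {σ : (eO Γ' O).Elt}
    (h : a.1 = σ.1 * trivIdem Γ') (g : invariants Γ' hΓ G) :
    (heckeSMul hle a g : G) = σ • (g : G) :=
  smul_eq_smul_of_mul_trivIdem_eq hle
    ((exists_eq_mul_trivIdem_of_mem_rightProj a.2.1).choose_spec.symm.trans h) g.2

variable (hΓ G) in
/-- The `o`-module structure `(σ e₁') g = σ g` on the `Γ'`-invariants of an
`e_{Γ/Γ'} O`-module. -/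
@[reducible] def invariantsModule : Module (heckeOrder Γ' O).Elt (invariants Γ' hΓ G) where
  smul := heckeSMul hle
  one_smul g := Subtype.ext <| (coe_heckeSMul hle (σ := 1) rfl g).trans (one_smul _ _)
  mul_smul a b g := by
    obtain ⟨σ, hσ⟩ := exists_eq_mul_trivIdem_of_mem_rightProj a.2.1
    obtain ⟨ρ, hρ⟩ := exists_eq_mul_trivIdem_of_mem_rightProj b.2.1
    have hab : (a * b).1 = (σ * ρ).1 * trivIdem Γ' := by
      change a.1 * b.1 = σ.1 * ρ.1 * trivIdem Γ'
      rw [mul_assoc, ← hρ, hσ, mul_assoc, trivIdem_mul Γ' b.2.2]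
    refine Subtype.ext ?_
    change (heckeSMul hle (a * b) g : G) = heckeSMul hle a (heckeSMul hle b g)
    rw [coe_heckeSMul hle hab, coe_heckeSMul hle hσ, coe_heckeSMul hle hρ, mul_smul]
  smul_zero a := Subtype.ext (smul_zero _)
  smul_add a g h := Subtype.ext (smul_add _ _ _)
  add_smul a b g := by
    obtain ⟨σ, hσ⟩ := exists_eq_mul_trivIdem_of_mem_rightProj a.2.1
    obtain ⟨ρ, hρ⟩ := exists_eq_mul_trivIdem_of_mem_rightProj b.2.1
    have hab : (a + b).1 = (σ + ρ).1 * trivIdem Γ' := by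
      change a.1 + b.1 = (σ.1 + ρ.1) * trivIdem Γ'
      rw [add_mul, ← hσ, ← hρ]
    refine Subtype.ext ?_
    change (heckeSMul hle (a + b) g : G) = heckeSMul hle a g + heckeSMul hle b g
    rw [coe_heckeSMul hle hab, coe_heckeSMul hle hσ, coe_heckeSMul hle hρ, add_smul]
  zero_smul g := Subtype.ext <|
    (coe_heckeSMul hle (σ := 0) (zero_mul _).symm g).trans (zero_smul _ _)

end HeckeAction

section TensorToInvariants

variable {hΓ} [Module (heckeOrder Γ' O).Elt (invariants Γ' hΓ G)]
  (hsmul : ∀ (a : (heckeOrder Γ' O).Elt) (σ : (eO Γ' O).Elt), a.1 = σ.1 * trivIdem Γ' →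
    ∀ g : invariants Γ' hΓ G, ((a • g : invariants Γ' hΓ G) : G) = σ • (g : G))

/-- The map `^{Γ'}(e_{Γ/Γ'} O) ⊗ G → ^{Γ'}G` given by `x ⊗ g ↦ x g`, for an `o`-module structure
on `^{Γ'}G` satisfying `(σ e₁') g = σ g`. -/
def tensorToInvariants :
    BTensor (heckeOrder Γ' O).Elt (eO Γ' O).Elt (leftInv Γ' O).Elt G
      →ₗ[(heckeOrder Γ' O).Elt] invariants Γ' hΓ G :=
  BTensor.lift
    (AddMonoidHom.mk' (fun x => AddMonoidHom.mk'
        (fun g => ⟨leftInv.incl Γ' O x • g, incl_smul_mem_invariants Γ' hΓ x g⟩)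
        fun g h => Subtype.ext (smul_add _ _ _))
      fun x y => AddMonoidHom.ext fun g =>
        Subtype.ext (add_smul (leftInv.incl Γ' O x) (leftInv.incl Γ' O y) g))
    (fun b x g => Subtype.ext (mul_smul (leftInv.incl Γ' O x) b g))
    (fun a x g => by
      obtain ⟨σ, hσ⟩ := exists_eq_mul_trivIdem_of_mem_rightProj a.2.1
      have hax : leftInv.incl Γ' O (a • x) = σ * leftInv.incl Γ' O x := by
        refine Subtype.ext ?_
        change a.1 * x.1 = σ.1 * x.1
        rw [hσ, mul_assoc, trivIdem_mul Γ' x.2.2]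
      refine Subtype.ext ((hsmul a σ hσ _).symm ▸ ?_)
      change leftInv.incl Γ' O (a • x) • g = σ • leftInv.incl Γ' O x • g
      rw [hax, mul_smul])

theorem coe_tensorToInvariants_btmul (x : (leftInv Γ' O).Elt) (g : G) :
    (tensorToInvariants hsmul (btmul _ _ x g) : G) = leftInv.incl Γ' O x • g := rfl

theorem mul_smul_eq_btmul_smul_tensorToInvariants (l : (leftInv Γ' O).Elt)
    {p : (rightProj Γ' O).Elt} {σ : (eO Γ' O).Elt} (hσ : p.1 = σ.1 * trivIdem Γ')
    (y : BTensor (heckeOrder Γ' O).Elt (eO Γ' O).Elt (leftInv Γ' O).Elt G) :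
    (leftInv Γ' O).mul (rightProj Γ' O) (leftInv_mul_rightProj_le Γ') l p • y =
      btmul _ _ l (σ • (tensorToInvariants hsmul y : G)) := by
  have h : DistribSMul.toAddMonoidHom _
      ((leftInv Γ' O).mul (rightProj Γ' O) (leftInv_mul_rightProj_le Γ') l p) =
        (BTensor.mk (heckeOrder Γ' O).Elt (eO Γ' O).Elt G l).comp
          ((DistribSMul.toAddMonoidHom G σ).comp ((invariants Γ' hΓ G).subtype.comp
            (tensorToInvariants hsmul).toAddMonoidHom)) := by
    ext x g
    change (leftInv Γ' O).mul (rightProj Γ' O) (leftInv_mul_rightProj_le Γ') l p •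
      btmul (heckeOrder Γ' O).Elt (eO Γ' O).Elt x g = btmul _ _ l (σ • leftInv.incl Γ' O x • g)
    rw [BTensor.smul_btmul, smul_smul, ← BTensor.op_smul_btmul]
    congr 1
    refine Subtype.ext ?_
    change l.1 * p.1 * x.1 = l.1 * (σ.1 * x.1)
    rw [hσ, mul_assoc, mul_assoc, trivIdem_mul Γ' x.2.2]
  exact DFunLike.congr_fun h y

theorem tensorToInvariants_bijective
    (hone : (heckeOrder Γ' O).one' ∈ (leftInv Γ' O).toSubmodule * (rightProj Γ' O).toSubmodule) :
    Function.Bijective (tensorToInvariants hsmul) := by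
  constructor
  · rw [injective_iff_map_eq_zero]
    intro y hy
    refine AddSubgroup.mem_bot.1 (SubBimodule.mem_of_forall_mul_smul_mem
      (leftInv_mul_rightProj_le Γ') hone ⊥ fun l p => ?_)
    obtain ⟨σ, hσ⟩ := exists_eq_mul_trivIdem_of_mem_rightProj p.2
    rw [AddSubgroup.mem_bot, mul_smul_eq_btmul_smul_tensorToInvariants hsmul l hσ, hy,
      ZeroMemClass.coe_zero, smul_zero, ← BTensor.mk_apply, map_zero]
  · intro g
    refine SubBimodule.mem_of_forall_mul_smul_mem (leftInv_mul_rightProj_le Γ') hone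
      (tensorToInvariants hsmul).range.toAddSubgroup fun l p => ?_
    obtain ⟨σ, hσ⟩ := exists_eq_mul_trivIdem_of_mem_rightProj p.2
    refine ⟨btmul _ _ l (σ • (g : G)), Subtype.ext ?_⟩
    rw [coe_tensorToInvariants_btmul, hsmul _ (leftInv.incl Γ' O l * σ), mul_smul]
    change l.1 * p.1 = l.1 * σ.1 * trivIdem Γ'
    rw [hσ, mul_assoc]

end TensorToInvariants

end Invariants

end HeckeModel

end

open HeckeModel in
theorem mainTheorem5_general {Γ : Type u} [Group Γ] [Finite Γ] (Γ' : Subgroup Γ)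
    (S : Set Nat.Primes)
    (hgood : ∀ p ∈ S, IsGoodPrime p (augIdem Γ'))
    (O : Subalgebra (zS S) (MonoidAlgebra ℚ Γ))
    (hord : IsOrder (zS S) 1 (Subalgebra.toSubmodule O))
    (hO : groupRing (zS S) Γ ≤ Subalgebra.toSubmodule O) :
    IsMoritaEquivalent (zS S) (eO Γ' O).Elt (heckeOrder Γ' O).Elt ∧
    (∃ E : ModuleCat.{max u v} (eO Γ' O).Elt ≌ ModuleCat.{max u v} (heckeOrder Γ' O).Elt,
      E.functor = tensorFunctor.{u, v} (heckeOrder Γ' O).Elt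
        (eO Γ' O).Elt (leftInv Γ' O).Elt ∧
      E.inverse = tensorFunctor.{u, v} (eO Γ' O).Elt
        (heckeOrder Γ' O).Elt (rightProj Γ' O).Elt) ∧
    (∀ (G : Type v) [AddCommGroup G] [Module (eO Γ' O).Elt G],
      ∃ _ : Module (heckeOrder Γ' O).Elt (invariants Γ' hO G),
        (∀ (a : (heckeOrder Γ' O).Elt) (σ : (eO Γ' O).Elt),
          a.1 = σ.1 * trivIdem Γ' →
          ∀ g : invariants Γ' hO G, ((a • g : invariants Γ' hO G) : G)
            = σ • (g : G)) ∧
        ∃ ψ : BTensor (heckeOrder Γ' O).Elt (eO Γ' O).Elt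
            (leftInv Γ' O).Elt G ≃ₗ[(heckeOrder Γ' O).Elt]
            invariants Γ' hO G,
          ∀ (x : (leftInv Γ' O).Elt) (g : G),
            ((ψ (btmul _ _ x g) : invariants Γ' hO G) : G) =
              leftInv.incl Γ' O x • g) := by
  have hmaxB : (eO Γ' O).IsMultiplierClosed :=
    (isMaximalOrder_eO Γ' hgood hord hO).isMultiplierClosed
  have hPQ := rightProj_mul_leftInv_eq Γ' hord hO hmaxB
  have hQP := leftInv_mul_rightProj_le Γ' (O := O)
  have hB := hPQ.ge (eO Γ' O).one_mem'
  have hC := one_mem_leftInv_mul_rightProj Γ' hgood hord hO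
  refine ⟨SubBimodule.isMoritaEquivalent hPQ.le hQP hB hC,
    ⟨SubBimodule.equivalence hPQ.le hQP hB hC, rfl, rfl⟩, fun G _ _ => ?_⟩
  have hle := eO_le_groupRing Γ' hgood hord hO
  let _ := invariantsModule hO G hle
  have hsmul : ∀ (a : (heckeOrder Γ' O).Elt) (σ : (eO Γ' O).Elt), a.1 = σ.1 * trivIdem Γ' →
      ∀ g : invariants Γ' hO G, ((a • g : invariants Γ' hO G) : G) = σ • (g : G) :=
    fun _ _ h g => coe_heckeSMul hle h g
  exact ⟨inferInstance, hsmul,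
    LinearEquiv.ofBijective _ (tensorToInvariants_bijective hsmul hC),
    coe_tensorToInvariants_btmul hsmul⟩

theorem mainTheorem5 {Γ : Type u} [Group Γ] [Finite Γ] (Γ' : Subgroup Γ)
    (S : Set Nat.Primes) (hS : S.Finite)
    (hgood : ∀ p ∈ S, HeckeModel.IsGoodPrime p (HeckeModel.augIdem Γ'))
    (O : Subalgebra (HeckeModel.zS S) (MonoidAlgebra ℚ Γ))
    (hmax : HeckeModel.IsMaximalOrder (HeckeModel.zS S) 1 (Subalgebra.toSubmodule O))
    (hO : HeckeModel.groupRing (HeckeModel.zS S) Γ ≤ Subalgebra.toSubmodule O) :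
    -- the two rings are Morita equivalent, as algebras over `ℤ_S`
    IsMoritaEquivalent (HeckeModel.zS S)
      (HeckeModel.eO Γ' O).Elt (HeckeModel.heckeOrder Γ' O).Elt ∧
    -- the two tensor functors are mutually inverse equivalences
    (∃ E : ModuleCat.{max u v} (HeckeModel.eO Γ' O).Elt ≌
        ModuleCat.{max u v} (HeckeModel.heckeOrder Γ' O).Elt,
      E.functor = HeckeModel.tensorFunctor.{u, v} (HeckeModel.heckeOrder Γ' O).Elt
        (HeckeModel.eO Γ' O).Elt (HeckeModel.leftInv Γ' O).Elt ∧
      E.inverse = HeckeModel.tensorFunctor.{u, v} (HeckeModel.eO Γ' O).Elt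
        (HeckeModel.heckeOrder Γ' O).Elt (HeckeModel.rightProj Γ' O).Elt) ∧
    -- `x ⊗ g ↦ x g` identifies the first functor with the `Γ'`-invariants, on which `o` acts by
    -- `(σ e₁') g = σ g`
    (∀ (G : Type v) [AddCommGroup G] [Module (HeckeModel.eO Γ' O).Elt G],
      ∃ _ : Module (HeckeModel.heckeOrder Γ' O).Elt (HeckeModel.invariants Γ' hO G),
        (∀ (a : (HeckeModel.heckeOrder Γ' O).Elt) (σ : (HeckeModel.eO Γ' O).Elt),
          a.1 = σ.1 * HeckeModel.trivIdem Γ' →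
          ∀ g : HeckeModel.invariants Γ' hO G, ((a • g : HeckeModel.invariants Γ' hO G) : G)
            = σ • (g : G)) ∧
        ∃ ψ : HeckeModel.BTensor (HeckeModel.heckeOrder Γ' O).Elt (HeckeModel.eO Γ' O).Elt
            (HeckeModel.leftInv Γ' O).Elt G ≃ₗ[(HeckeModel.heckeOrder Γ' O).Elt]
            HeckeModel.invariants Γ' hO G,
          ∀ (x : (HeckeModel.leftInv Γ' O).Elt) (g : G),
            ((ψ (HeckeModel.btmul _ _ x g) : HeckeModel.invariants Γ' hO G) : G) =
              HeckeModel.leftInv.incl Γ' O x • g) :=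
  mainTheorem5_general Γ' S hgood O hmax.1 hO
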